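/- Let $D=2d$ and write points of phase space $\mathbb R^{D}$ as $x=(p,q)$ with $p,q\in\mathbb R^d$ (Euclidean norms throughout). Let $W\in C^2_c(\mathbb R^d)$ be even and let $\Phi\in C^2(\mathbb R^d)$ be polynomially bounded, $|\Phi(q)|\le B_1(1+|q|)^{b_2}$. For a finite Borel measure $\mu$ on $\mathbb R^D$ put $(W*\mu)(q)=\int W(q-q')\,d\mu(p',q')$, $\nabla_W\mathscr H(\mu)(p,q)=\bigl(p,\nabla(W*\mu+\Phi)(q)\bigr)$ and $J(p,q)=(-q,p)$, so that $J\nabla_W\mathscr H(\mu)(p,q)=\bigl(-\nabla(W*\mu+\Phi)(q),p\bigr)$. A family $(\mu_i)$ converges distributionally to $\mu$ if $\int\varphi\,d\mu_i\to\int\varphi\,d\mu$ for all $\varphi\in C_c^\infty(\mathbb R^D)$. **Dynamical (no-return) hypothesis.** There are a constant $B$ with $|\nabla W(q)|<B$ for all $q$, a function $u\in C^2(\mathbb R)$ with $u'(r)\ge B+\max_{|e|=1}\langle\nabla\Phi(re),e\rangle$ for all $r\ge 0$, and points $q_L^\star\in\mathbb R^d$ ($L\ge1$) such that $|q_L^\star|$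 increases to $\infty$ and $u(|q|)<u(|q_L^\star|)$ whenever $|q|>|q_L^\star|$. **Construction of the deficient solutions.** For $\varepsilon>0$, a locally Lipschitz field $v$ on $\mathbb R^D$, a finite measure $\mu$ and $s\ge0$, let $X_r(x)$ be the solution of $\dot X_r=v(X_r)$, $X_0=x$, let $\mathbb S_s$ be the set of those $x$ for which it exists on $[0,s]$, and let $E^{\varepsilon,v}_s\mu$ be the measure given by $$\int\psi\,d(E^{\varepsilon,v}_s\mu)=\int_{\mathbb S_s}\exp\Bigl(-\varepsilon\int_0^s|v(X_r(x))|\,dr\Bigr)\psi(X_s(x))\,d\mu(x).$$ Given $T>0$, an initial measure $\mu_0$ and $n\ge1$, put $h=T/n$ and define $\mu^{\varepsilon,n}_0=\mu_0$ and $\mu^{\varepsilon,n}_{t}=E^{\varepsilon,v_k}_{t-kh}\,\mu^{\varepsilon,n}_{kh}$ for $kh\le t\le(k+1)h$, where $v_k=J\nabla_W\mathscr H(\mu^{\varepsilon,n}_{kh})$. A deficient solution $(\mu^\varepsilon_t)_{t\in[0,T]}$ is a curve of finite Borel measures such that, along some strictly increasing sequence $n_j$, $\mu^{\varepsilon,n_j}_t\to\mu^\varepsilon_t$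 distributionally for every $t\in[0,T]$. **Theorem.** Let $0<T<\infty$ and $\alpha_0>0$, let $W,\Phi$ be as above and satisfy the dynamical hypothesis, and let $\mu_0$ be a Borel measure on $\mathbb R^D$ of total mass $1$ with $\int e^{\alpha_0|x|}\,d\mu_0(x)<\infty$. Then for every $\varepsilon>0$ a deficient solution exists. Moreover, for every choice of deficient solutions $(\mu^\varepsilon_t)_{t\in[0,T]}$, $\varepsilon>0$, there are a sequence of positive numbers $\varepsilon_k$ strictly decreasing to $0$ and Borel measures $(\mu_t)_{t\in[0,T]}$, starting at the given $\mu_0$, such that $\mu^{\varepsilon_k}_t\to\mu_t$ distributionally for every $t\in[0,T]$, and (i) $t\mapsto\mu_t$ is distributionally continuous on $[0,T]$ and $\mu_t(\mathbb R^D)\le1$ for all $t\in[0,T]$; (ii) $(\mu_t)_{t\in[0,T]}$ solves the Hamiltonian ODE $\partial_t\mu_t+\nabla\cdot\bigl(J\nabla_W\mathscr H(\mu_t)\,\mu_t\bigr)=0$ in the distributional sense: for every $\varphi\in C_c^\infty((0,T)\times\mathbb R^D)$ the function $t\mapsto\int\bigl(\partial_t\varphi+\langle J\nabla_W\mathscr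 H(\mu_t),\nabla\varphi\rangle\bigr)\,d\mu_t$ is integrable on $(0,T)$ and $$\int_0^T\int_{\mathbb R^D}\bigl(\partial_t\varphi+\langle J\nabla_W\mathscr H(\mu_t),\nabla\varphi\rangle\bigr)\,d\mu_t\,dt=0 .$$ -/

import Mathlib

open MeasureTheory Set Filter Topology
open scoped ContDiff

noncomputable section

/-- Position space (and momentum space) `ℝ^d` with its Euclidean norm. -/
abbrev Pos (d : ℕ) : Type := EuclideanSpace ℝ (Fin d)

/-- Phase space `ℝ^D`, `D = 2d`, with its Euclidean norm.  A point is `x = (p, q)`: the first `d`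
coordinates (`Sum.inl`) are the momentum `p`, the last `d` (`Sum.inr`) are the position `q`. -/
abbrev Phase (d : ℕ) : Type := EuclideanSpace ℝ (Fin d ⊕ Fin d)

/-- The momentum `p` of `x = (p, q)`. -/
def momentum {d : ℕ} (x : Phase d) : Pos d := WithLp.toLp 2 fun i => x (Sum.inl i)

/-- The position `q` of `x = (p, q)`. -/
def position {d : ℕ} (x : Phase d) : Pos d := WithLp.toLp 2 fun i => x (Sum.inr i)

/-- The phase space point `(p, q)`. -/
def phasePoint {d : ℕ} (p q : Pos d) : Phase d := WithLp.toLp 2 (Sum.elim p q)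

/-- The standing assumptions on the interaction potential `W` and the external potential `Φ`. -/
structure AdmissiblePotentials {d : ℕ} (W Φ : Pos d → ℝ) : Prop where
  W_contDiff : ContDiff ℝ 2 W
  W_compact : HasCompactSupport W
  W_even : ∀ q, W (-q) = W q
  Φ_contDiff : ContDiff ℝ 2 Φ
  Φ_poly : ∃ (B₁ : ℝ) (b₂ : ℕ), ∀ q, |Φ q| ≤ B₁ * (1 + ‖q‖) ^ b₂

/-- `(W * μ)(q) = ∫ W (q - q') dμ(p', q')`. -/
def interaction {d : ℕ} (W : Pos d → ℝ) (μ : Measure (Phase d)) (q : Pos d) : ℝ :=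
  ∫ x, W (q - position x) ∂μ

/-- The Wasserstein gradient `∇_W 𝓗(μ)(p, q) = (p, ∇(W * μ + Φ)(q))` of the Hamiltonian
`𝓗(μ) = ½ ∫ |p|² dμ + ½ ∫ (W * μ)(q) dμ + ∫ Φ(q) dμ`. -/
def wassersteinGrad {d : ℕ} (W Φ : Pos d → ℝ) (μ : Measure (Phase d)) (x : Phase d) : Phase d :=
  phasePoint (momentum x) (gradient (fun q => interaction W μ q + Φ q) (position x))

/-- The symplectic matrix `J (p, q) = (-q, p)`. -/
def sympJ {d : ℕ} (x : Phase d) : Phase d := phasePoint (-position x) (momentum x)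

/-- The Hamiltonian velocity field `J ∇_W 𝓗(μ)`. -/
def hamField {d : ℕ} (W Φ : Pos d → ℝ) (μ : Measure (Phase d)) (x : Phase d) : Phase d :=
  sympJ (wassersteinGrad W Φ μ x)

/-- `γ` solves `γ' = v(γ)` on `[0, s]` with `γ 0 = x`. -/
def IsTrajectory {d : ℕ} (v : Phase d → Phase d) (s : ℝ) (x : Phase d) (γ : ℝ → Phase d) : Prop :=
  γ 0 = x ∧ ∀ r ∈ Icc 0 s, HasDerivWithinAt γ (v (γ r)) (Icc 0 s) r

/-- The set `𝕊_s` of the initial points whose trajectory has not blown up by time `s`. -/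
def aliveSet {d : ℕ} (v : Phase d → Phase d) (s : ℝ) : Set (Phase d) :=
  {x | ∃ γ, IsTrajectory v s x γ}

open Classical in
/-- The trajectory `r ↦ X_r(x)`, `0 ≤ r ≤ s`, for `x ∈ 𝕊_s` (it is unique when `v` is locally
Lipschitz); the constant path if `x ∉ 𝕊_s`. -/
def trajectory {d : ℕ} (v : Phase d → Phase d) (s : ℝ) (x : Phase d) : ℝ → Phase d :=
  if h : ∃ γ, IsTrajectory v s x γ then h.choose else fun _ => x

/-- The remaining fraction of mass `(R_s ∘ X_s)(x) = exp (-ε ∫₀ˢ |v(X_r(x))| dr)`. -/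
def massFactor {d : ℕ} (ε : ℝ) (v : Phase d → Phase d) (s : ℝ) (x : Phase d) : ℝ :=
  Real.exp (-(ε * ∫ r in (0 : ℝ)..s, ‖v (trajectory v s x r)‖))

/-- The solution at time `s` of the deficient continuity equation
`∂ₛ μₛ + ∇·(v μₛ) = -ε |v| μₛ` with time-independent field `v` and initial measure `μ`, given by
`∫ ψ dμₛ = ∫_{𝕊_s} (R_s ψ) ∘ X_s dμ`. -/
def deficientEvolution {d : ℕ} (ε : ℝ) (v : Phase d → Phase d) (s : ℝ) (μ : Measure (Phase d)) :
    Measure (Phase d) :=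
  ((μ.restrict (aliveSet v s)).withDensity fun x => ENNReal.ofReal (massFactor ε v s x)).map
    fun x => trajectory v s x s

/-- The time-discretized measures at the times `0, h, 2h, …`: on each step the velocity is frozen
at its value at the beginning of the step. -/
def discreteNode {d : ℕ} (W Φ : Pos d → ℝ) (ε h : ℝ) (μ₀ : Measure (Phase d)) :
    ℕ → Measure (Phase d)
  | 0 => μ₀
  | k + 1 => deficientEvolution ε (hamField W Φ (discreteNode W Φ ε h μ₀ k)) h
      (discreteNode W Φ ε h μ₀ k)

/-- The time-discretized measure at any time `t ≥ 0`: if `k h ≤ t < (k + 1) h`, start from the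
measure at time `k h` and evolve for the time `t - k h` with the frozen velocity. -/
def discretized {d : ℕ} (W Φ : Pos d → ℝ) (ε h : ℝ) (μ₀ : Measure (Phase d)) (t : ℝ) :
    Measure (Phase d) :=
  deficientEvolution ε (hamField W Φ (discreteNode W Φ ε h μ₀ ⌊t / h⌋₊)) (t - ⌊t / h⌋₊ * h)
    (discreteNode W Φ ε h μ₀ ⌊t / h⌋₊)

/-- Distributional convergence: convergence of the integrals of all `φ ∈ C_c^∞(ℝ^D)`. -/
def DistTendsto {d : ℕ} {ι : Type*} (μ : ι → Measure (Phase d)) (l : Filter ι)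
    (ν : Measure (Phase d)) : Prop :=
  ∀ φ : Phase d → ℝ, ContDiff ℝ ∞ φ → HasCompactSupport φ →
    Tendsto (fun i => ∫ x, φ x ∂(μ i)) l (𝓝 (∫ x, φ x ∂ν))

/-- `(μ_t)_{t ∈ [0,T]}` is a solution `μ^ε` of the deficient Hamiltonian ODE with initial measure
`μ₀`, as constructed by time discretization: a curve of finite measures which, for every `t ∈ [0,T]`, is the
distributional limit of the discretized measures with step `T / n`, along one subsequence of `n`. -/
def IsDiscretizationLimit {d : ℕ} (W Φ : Pos d → ℝ) (T ε : ℝ) (μ₀ : Measure (Phase d))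
    (μ : ℝ → Measure (Phase d)) : Prop :=
  (∀ t ∈ Icc 0 T, IsFiniteMeasure (μ t)) ∧
  ∃ n : ℕ → ℕ, StrictMono n ∧ (∀ k, 0 < n k) ∧
    ∀ t ∈ Icc 0 T, DistTendsto (fun k => discretized W Φ ε (T / n k) μ₀ t) atTop (μ t)

/-- `∂_t μ_t + ∇·(J ∇_W 𝓗(μ_t) μ_t) = 0`, tested against all `φ ∈ C_c^∞((0,T) × ℝ^D)`. -/
def SolvesHamiltonianODE {d : ℕ} (W Φ : Pos d → ℝ) (T : ℝ) (μ : ℝ → Measure (Phase d)) : Prop :=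
  ∀ φ : ℝ × Phase d → ℝ, ContDiff ℝ ∞ φ → HasCompactSupport φ →
    tsupport φ ⊆ Ioo 0 T ×ˢ univ →
    IntervalIntegrable (fun t => ∫ x, (fderiv ℝ φ (t, x) (1, 0) +
      fderiv ℝ φ (t, x) (0, hamField W Φ (μ t) x)) ∂(μ t)) volume 0 T ∧
    ∫ t in (0 : ℝ)..T, ∫ x, (fderiv ℝ φ (t, x) (1, 0) +
      fderiv ℝ φ (t, x) (0, hamField W Φ (μ t) x)) ∂(μ t) = 0

/-- The dynamical (no-return) hypothesis.  `B` bounds `|∇(W * μ)|` for all `μ` of mass at most `1`;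
`u` satisfies `u'(r) ≥ B + max_{|q| = r} ⟨∇Φ(q), q / |q|⟩`, where `q = r e` and `|e| = 1`;
and `Υ(q) = u(|q|)` has a sequence of no-return points `q*_L`. -/
def DynamicalHypothesis {d : ℕ} (W Φ : Pos d → ℝ) : Prop :=
  ∃ B : ℝ, (∀ q, ‖gradient W q‖ < B) ∧
  ∃ u : ℝ → ℝ, ContDiff ℝ 2 u ∧
    (∀ r : ℝ, 0 ≤ r → ∀ e : Pos d, ‖e‖ = 1 →
      B + inner ℝ (gradient Φ (r • e)) e ≤ deriv u r) ∧
  ∃ qs : ℕ → Pos d, Monotone (fun L => ‖qs L‖) ∧ Tendsto (fun L => ‖qs L‖) atTop atTop ∧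
    ∀ (L : ℕ) (q : Pos d), ‖qs L‖ < ‖q‖ → u ‖q‖ < u ‖qs L‖

end

/-!
Existence of deficient solutions and convergence, as the deficiency vanishes, to a distributional
solution of the Hamiltonian ODE.

**Compactness.** For a test function `φ` of compact support, the derivative of `t ↦ ∫ φ dμ_t` along
the discretized curves is the integral of `∂ₜφ + ⟨v, ∇φ⟩ - ε |v| φ`, which is bounded uniformly in
the step size and for bounded `ε`, because the fields `v` generated by sub-probability measures are
uniformly bounded on compact sets.  Hence the curves are equi-Lipschitz against each test function,
and a Helly selection (`exists_subseq_distTendsto`) gives distributional limits along a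
subsequence, simultaneously at all times.  It is applied to the step size for fixed `ε`, and then
to the sequence of deficiencies.

**Trajectories that blow up.** They leave every compact set before their final time, so the
transported test function vanishes there continuously (`continuousOn_transported`).  The weak form
of one step (`hasDerivWithinAt_integral_deficientEvolution`) therefore has no boundary term from the
mass that escapes.  Existence, openness of `aliveSet` and continuity in the initial point are
deduced from bounded, globally Lipschitz truncations of the field.

**Passage to the limit in the field.** `W` has compact support in the position only, so
distributional convergence alone does not control `∇W * μ`: mass could escape to infinite momentum
over a bounded set of positions.  The no-return hypothesis excludes this.  With `r = |q|` and
`w = ṙ`, the choice of `u` gives `ẇ > -u'(r)` for every field generated by a sub-probability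
measure, so `w² / 2 + u(r)` increases while `w ≥ 0`, and a particle that crosses a barrier radius
`R = |q*_L|` outward never turns back: `escapeSet` is forward invariant.  A particle that starts in
a ball and is found later in a smaller ball has stayed within `R` meanwhile, where the force is
bounded; its momentum has grown at most linearly (`mem_trapSet`).  Since the trap sets do not depend
on the frozen field, the argument goes through all steps of the discretization
(`discretized_compl_trapSet_le`) and gives a bound on the mass at high momentum over bounded
positions that is uniform in step size, deficiency and time
(`exists_momentumTight_discretized`), and is inherited by limits.

Under this momentum tightness the fields converge locally uniformly, and the weak formulation is
stable (`isWeakSolution_of_tendsto`): once as the step size tends to zero, where the node measures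
generating the field have the same limit as the curve, and once as `ε → 0`, where the term
`ε |v| φ` disappears.
-/

/-! ### Distributional convergence of sub-probability measures -/

lemma isFiniteMeasure_of_le_one {d : ℕ} {μ : Measure (Phase d)} (h : μ univ ≤ 1) :
    IsFiniteMeasure μ :=
  ⟨lt_of_le_of_lt h ENNReal.one_lt_top⟩

lemma measureReal_univ_le_one {d : ℕ} {μ : Measure (Phase d)} (h : μ univ ≤ 1) :
    μ.real univ ≤ 1 := by
  simpa [Measure.real] using ENNReal.toReal_mono ENNReal.one_ne_top h

lemma norm_integral_le_of_mass_le_one {d : ℕ} {F : Type*} [NormedAddCommGroup F] [NormedSpace ℝ F]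
    {μ : Measure (Phase d)} (h : μ univ ≤ 1) {f : Phase d → F} {C : ℝ} (hC : 0 ≤ C)
    (hf : ∀ x, ‖f x‖ ≤ C) : ‖∫ x, f x ∂μ‖ ≤ C := by
  have := isFiniteMeasure_of_le_one h
  calc ‖∫ x, f x ∂μ‖ ≤ C * μ.real univ :=
        norm_integral_le_of_norm_le_const (Eventually.of_forall hf)
    _ ≤ C * 1 := by gcongr; exact measureReal_univ_le_one h
    _ = C := mul_one C

lemma abs_integral_sub_le {d : ℕ} {μ : Measure (Phase d)} [IsFiniteMeasure μ]
    {f g : Phase d → ℝ} {δ : ℝ} (hf : Integrable f μ) (hg : Integrable g μ)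
    (hfg : ∀ x, |f x - g x| ≤ δ) : |∫ x, f x ∂μ - ∫ x, g x ∂μ| ≤ δ * μ.real univ := by
  rw [← integral_sub hf hg, ← Real.norm_eq_abs]
  exact norm_integral_le_of_norm_le_const (Eventually.of_forall hfg)

lemma abs_integral_sub_le_of_mass_le_one {d : ℕ} {μ : Measure (Phase d)} (h : μ univ ≤ 1)
    {f g : Phase d → ℝ} {δ : ℝ} (hδ : 0 ≤ δ) (hf : Integrable f μ) (hg : Integrable g μ)
    (hfg : ∀ x, |f x - g x| ≤ δ) : |∫ x, f x ∂μ - ∫ x, g x ∂μ| ≤ δ := by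
  have := isFiniteMeasure_of_le_one h
  calc _ ≤ δ * μ.real univ := abs_integral_sub_le hf hg hfg
    _ ≤ δ * 1 := by gcongr; exact measureReal_univ_le_one h
    _ = δ := mul_one δ

/-- For sub-probability measures, distributional convergence extends from smooth to continuous
compactly supported test functions. -/
lemma DistTendsto.tendsto_integral {d : ℕ} {ι : Type*} {μ : ι → Measure (Phase d)} {l : Filter ι}
    {ν : Measure (Phase d)} (h : DistTendsto μ l ν) [IsFiniteMeasure ν]
    (hμ : ∀ᶠ i in l, μ i univ ≤ 1) {f : Phase d → ℝ} (hf : Continuous f)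
    (hfc : HasCompactSupport f) :
    Tendsto (fun i => ∫ x, f x ∂(μ i)) l (𝓝 (∫ x, f x ∂ν)) := by
  rw [Metric.tendsto_nhds]
  intro δ hδ
  set η : ℝ := δ / (3 * (1 + ν.real univ)) with hη
  have hν0 : 0 ≤ ν.real univ := measureReal_nonneg
  have hη0 : 0 < η := by positivity
  obtain ⟨g, hg1, hg2, hg3⟩ := hf.exists_contDiff_approx ⊤ (ε := fun _ => η) continuous_const
    (fun _ => hη0)
  have hgc : HasCompactSupport g := hfc.mono hg3
  have hfg : ∀ x, |f x - g x| ≤ η := fun x => by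
    have := (hg2 x).le
    rwa [dist_comm, Real.dist_eq] at this
  have hprod : η * (1 + ν.real univ) = δ / 3 := by
    rw [hη]; field_simp
  filter_upwards [hμ, Metric.tendsto_nhds.1 (h g hg1 hgc) (δ / 3) (by positivity)] with i hi hi2
  have := isFiniteMeasure_of_le_one hi
  have e1 := abs_integral_sub_le_of_mass_le_one hi hη0.le (hf.integrable_of_hasCompactSupport hfc)
    (hg1.continuous.integrable_of_hasCompactSupport hgc) hfg
  have e2 := abs_integral_sub_le (μ := ν) (hf.integrable_of_hasCompactSupport hfc)
    (hg1.continuous.integrable_of_hasCompactSupport hgc) hfg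
  rw [Real.dist_eq, abs_lt] at hi2 ⊢
  rw [abs_le] at e1 e2
  have : 0 ≤ η * ν.real univ := by positivity
  constructor <;> linarith [hi2.1, hi2.2, e1.1, e1.2, e2.1, e2.2]

/-- Mass of open sets is lower semicontinuous under distributional convergence. -/
lemma DistTendsto.measure_le_of_isOpen {d : ℕ} {ι : Type*} {μ : ι → Measure (Phase d)}
    {l : Filter ι} [l.NeBot] {ν : Measure (Phase d)} (h : DistTendsto μ l ν) [IsFiniteMeasure ν]
    (hμ : ∀ᶠ i in l, μ i univ ≤ 1) {U : Set (Phase d)} (hU : IsOpen U) {c : ENNReal}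
    (hc : ∀ᶠ i in l, μ i U ≤ c) : ν U ≤ c := by
  by_cases hct : c = ⊤
  · simp [hct]
  rw [hU.measure_eq_iSup_isCompact]
  refine iSup_le fun K => iSup_le fun hKU => iSup_le fun hK => ?_
  obtain ⟨f, hf1, hf2, hf3, hf4⟩ := exists_continuousMap_one_of_isCompact_subset_isOpen hK hU hKU
  have hfc : HasCompactSupport f := hf2
  have hlim := h.tendsto_integral hμ f.continuous hfc
  have hle : ∫ x, f x ∂ν ≤ c.toReal := by
    refine le_of_tendsto hlim ?_
    filter_upwards [hμ, hc] with i hi hci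
    have := isFiniteMeasure_of_le_one hi
    calc ∫ x, f x ∂(μ i) ≤ ∫ x, U.indicator 1 x ∂(μ i) := by
          refine integral_mono (f.continuous.integrable_of_hasCompactSupport hfc)
            ((integrable_const (1 : ℝ)).indicator hU.measurableSet) fun x => ?_
          by_cases hx : x ∈ U
          · simpa [hx] using (hf4 x).2
          · have : f x = 0 := image_eq_zero_of_notMem_tsupport fun hx' => hx (hf3 hx')
            simp [hx, this]
      _ = (μ i).real U := integral_indicator_one hU.measurableSet
      _ ≤ c.toReal := ENNReal.toReal_mono hct hci
  have hK' : ν.real K ≤ ∫ x, f x ∂ν := by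
    rw [← integral_indicator_one hK.measurableSet]
    refine integral_mono ((integrable_const (1 : ℝ)).indicator hK.measurableSet)
      (f.continuous.integrable_of_hasCompactSupport hfc) fun x => ?_
    by_cases hx : x ∈ K
    · simp [hx, hf1 hx]
    · simpa [hx] using (hf4 x).1
  rw [← ENNReal.toReal_le_toReal (measure_ne_top ν K) hct]
  exact hK'.trans hle

lemma DistTendsto.measure_univ_le_one {d : ℕ} {ι : Type*} {μ : ι → Measure (Phase d)}
    {l : Filter ι} [l.NeBot] {ν : Measure (Phase d)} (h : DistTendsto μ l ν) [IsFiniteMeasure ν]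
    (hμ : ∀ᶠ i in l, μ i univ ≤ 1) : ν univ ≤ 1 :=
  h.measure_le_of_isOpen hμ isOpen_univ hμ

lemma DistTendsto.unique {d : ℕ} {ι : Type*} {μ : ι → Measure (Phase d)}
    {l : Filter ι} [l.NeBot] {ν ν' : Measure (Phase d)} [IsFiniteMeasure ν] [IsFiniteMeasure ν']
    (h : DistTendsto μ l ν) (h' : DistTendsto μ l ν') (hμ : ∀ᶠ i in l, μ i univ ≤ 1) :
    ν = ν' :=
  Measure.ext_of_integral_eq_on_compactlySupported fun f =>
    tendsto_nhds_unique (h.tendsto_integral hμ f.continuous f.hasCompactSupport)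
      (h'.tendsto_integral hμ f.continuous f.hasCompactSupport)

/-- Vague compactness: along an ultrafilter, sub-probability measures converge against every
continuous compactly supported function.  The limit of the integrals is a positive functional,
represented by a measure through the Riesz–Markov–Kakutani theorem. -/
lemma exists_measure_tendsto_ultrafilter {d : ℕ} {ι : Type*} (U : Ultrafilter ι)
    {μ : ι → Measure (Phase d)} (hμ : ∀ i, μ i univ ≤ 1) :
    ∃ ν : Measure (Phase d), ν univ ≤ 1 ∧ ∀ f : Phase d → ℝ, Continuous f → HasCompactSupport f →
      Tendsto (fun i => ∫ x, f x ∂(μ i)) U (𝓝 (∫ x, f x ∂ν)) := by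
  have := fun i => isFiniteMeasure_of_le_one (hμ i)
  have key : ∀ f : CompactlySupportedContinuousMap (Phase d) ℝ,
      ∃ a : ℝ, Tendsto (fun i => ∫ x, f x ∂(μ i)) U (𝓝 a) := by
    intro f
    obtain ⟨C, hC⟩ := f.continuous.bounded_above_of_compact_support f.hasCompactSupport
    have hmem : ∀ i, ∫ x, f x ∂(μ i) ∈ Metric.closedBall (0 : ℝ) (max C 0) := fun i => by
      rw [mem_closedBall_zero_iff]
      exact norm_integral_le_of_mass_le_one (hμ i) (le_max_right _ _)
        fun x => (hC x).trans (le_max_left _ _)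
    obtain ⟨a, -, ha⟩ := (isCompact_closedBall (0 : ℝ) (max C 0)).ultrafilter_le_nhds
      (U.map fun i => ∫ x, f x ∂(μ i)) (by
        simp only [le_principal_iff, Ultrafilter.mem_coe, Ultrafilter.mem_map]
        exact Filter.univ_mem' hmem)
    exact ⟨a, ha⟩
  have hint : ∀ (f : CompactlySupportedContinuousMap (Phase d) ℝ) i, Integrable f (μ i) :=
    fun f i => f.continuous.integrable_of_hasCompactSupport f.hasCompactSupport
  choose Λ hΛ using key
  let Λ' : CompactlySupportedContinuousMap (Phase d) ℝ →ₚ[ℝ] ℝ :=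
  { toFun := Λ
    map_add' := fun g g' => by
      have h1 := (hΛ g).add (hΛ g')
      simp_rw [← integral_add (hint g _) (hint g' _)] at h1
      exact tendsto_nhds_unique (hΛ (g + g')) h1
    map_smul' := fun c g => by
      have h1 := (hΛ g).const_smul c
      simp_rw [← integral_smul] at h1
      exact tendsto_nhds_unique (hΛ (c • g)) h1
    monotone' := fun g g' hgg' =>
      le_of_tendsto_of_tendsto' (hΛ g) (hΛ g') fun i =>
        integral_mono (hint g i) (hint g' i) hgg' }
  refine ⟨RealRMK.rieszMeasure Λ', ?_, fun f hf hfc => ?_⟩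
  · rw [isOpen_univ.measure_eq_iSup_isCompact]
    refine iSup_le fun K => iSup_le fun hKU => iSup_le fun hK => ?_
    obtain ⟨f, hf1, hf2, hf3, hf4⟩ :=
      exists_continuousMap_one_of_isCompact_subset_isOpen hK isOpen_univ hKU
    let f' : CompactlySupportedContinuousMap (Phase d) ℝ := ⟨f, hf2⟩
    have h1 := RealRMK.rieszMeasure_le_of_eq_one Λ' (f := f') (fun x => (hf4 x).1) hK
      (fun x hx => hf1 hx)
    refine h1.trans (ENNReal.ofReal_le_one.2 (le_of_tendsto' (hΛ f') fun i => ?_))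
    refine (Real.le_norm_self _).trans
      (norm_integral_le_of_mass_le_one (hμ i) zero_le_one fun x => ?_)
    exact abs_le.2 ⟨(by norm_num : (-1 : ℝ) ≤ 0).trans (hf4 x).1, (hf4 x).2⟩
  · have h1 := hΛ ⟨⟨f, hf⟩, hfc⟩
    have h2 := RealRMK.integral_rieszMeasure Λ' ⟨⟨f, hf⟩, hfc⟩
    have h3 : Λ' ⟨⟨f, hf⟩, hfc⟩ = Λ ⟨⟨f, hf⟩, hfc⟩ := rfl
    rw [h3] at h2
    rw [← h2] at h1
    exact h1

/-- A countable family of smooth compactly supported functions that is uniformly dense in all of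
them. -/
lemma exists_dense_seq_smooth (d : ℕ) : ∃ φ : ℕ × ℕ → Phase d → ℝ,
    (∀ j, ContDiff ℝ ∞ (φ j)) ∧ (∀ j, HasCompactSupport (φ j)) ∧
    ∀ f : Phase d → ℝ, ContDiff ℝ ∞ f → HasCompactSupport f → ∀ δ > 0,
      ∃ j, ∀ x, |f x - φ j x| ≤ δ := by
  let S : ℕ → Set C(Phase d, ℝ) := fun R =>
    {f | ContDiff ℝ ∞ f ∧ ∀ x, x ∉ Metric.closedBall (0 : Phase d) R → f x = 0}
  have hne : ∀ R, Nonempty (S R) := fun R => ⟨⟨0, by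
    refine ⟨?_, fun x _ => rfl⟩
    exact contDiff_const⟩⟩
  let φ : ℕ × ℕ → C(Phase d, ℝ) := fun j => (TopologicalSpace.denseSeq (S j.1) j.2 : S j.1)
  have hφ : ∀ j, φ j ∈ S j.1 := fun j => Subtype.prop _
  refine ⟨fun j => φ j, fun j => (hφ j).1, fun j =>
    HasCompactSupport.intro (isCompact_closedBall (0 : Phase d) j.1) (hφ j).2, ?_⟩
  intro f hf hfc δ hδ
  obtain ⟨R, hR⟩ := hfc.isCompact.isBounded.subset_closedBall (0 : Phase d)
  obtain ⟨N, hN⟩ := exists_nat_ge R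
  have hfS : (⟨f, hf.continuous⟩ : C(Phase d, ℝ)) ∈ S N := by
    refine ⟨hf, fun x hx => ?_⟩
    have : x ∉ tsupport f := fun hx' => hx (Metric.closedBall_subset_closedBall hN (hR hx'))
    exact image_eq_zero_of_notMem_tsupport this
  have hnhds : {g : C(Phase d, ℝ) | ∀ x ∈ Metric.closedBall (0 : Phase d) N,
      dist (f x) (g x) < δ} ∈ 𝓝 (⟨f, hf.continuous⟩ : C(Phase d, ℝ)) := by
    have hb := nhds_basis_uniformity' (x := (⟨f, hf.continuous⟩ : C(Phase d, ℝ)))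
      (Metric.uniformity_basis_dist (α := ℝ)).compactConvergenceUniformity
    exact hb.mem_of_mem (i := (Metric.closedBall (0 : Phase d) N, δ))
      ⟨isCompact_closedBall _ _, hδ⟩
  obtain ⟨j, hj⟩ := (TopologicalSpace.denseRange_denseSeq (S N)).mem_nhds
    (x := ⟨_, hfS⟩) (continuous_subtype_val.continuousAt.preimage_mem_nhds hnhds)
  refine ⟨(N, j), fun x => ?_⟩
  by_cases hx : x ∈ Metric.closedBall (0 : Phase d) N
  · have := (hj x hx).le
    rwa [Real.dist_eq] at this
  · have h1 := hfS.2 x hx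
    have h2 := (hφ (N, j)).2 x hx
    simp only [ContinuousMap.coe_mk] at h1
    simp only [h1, h2, sub_zero, abs_zero, hδ.le]

/-- Helly selection: a sequence of curves of sub-probability measures whose integrals against each
smooth test function are Lipschitz in time, uniformly along the sequence, has a subsequence that
converges distributionally at every time. -/
theorem exists_subseq_distTendsto {d : ℕ} {T : ℝ} (hT : 0 ≤ T) (m : ℕ → ℝ → Measure (Phase d))
    (hm : ∀ n, ∀ t ∈ Icc 0 T, m n t univ ≤ 1)
    (hLip : ∀ φ : Phase d → ℝ, ContDiff ℝ ∞ φ → HasCompactSupport φ → ∃ C : ℝ, ∀ n,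
      ∀ s ∈ Icc 0 T, ∀ t ∈ Icc 0 T, |∫ x, φ x ∂(m n t) - ∫ x, φ x ∂(m n s)| ≤ C * |t - s|) :
    ∃ σ : ℕ → ℕ, StrictMono σ ∧ ∃ ν : ℝ → Measure (Phase d), (∀ t, ν t univ ≤ 1) ∧
      ∀ t ∈ Icc 0 T, DistTendsto (fun k => m (σ k) t) atTop (ν t) := by
  obtain ⟨φ, hφ1, hφ2, hφ3⟩ := exists_dense_seq_smooth d
  have : Nonempty (Icc 0 T) := ⟨⟨0, le_refl _, hT⟩⟩
  let q : ℕ → Icc 0 T := TopologicalSpace.denseSeq (Icc 0 T)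
  have hq : DenseRange q := TopologicalSpace.denseRange_denseSeq _
  choose B hB using fun j => (hφ1 j).continuous.bounded_above_of_compact_support (hφ2 j)
  let a : ℕ → (ℕ × ℕ) × ℕ → ℝ := fun n i => ∫ x, φ i.1 x ∂(m n (q i.2))
  have hcomp : IsCompact (Set.pi univ fun i : (ℕ × ℕ) × ℕ =>
      Metric.closedBall (0 : ℝ) (max (B i.1) 0)) :=
    isCompact_univ_pi fun i => isCompact_closedBall _ _
  obtain ⟨b, -, σ, hσ, hlim⟩ := hcomp.tendsto_subseq (x := a) fun n i _ => by
    rw [mem_closedBall_zero_iff]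
    exact norm_integral_le_of_mass_le_one (hm n _ (q i.2).2) (le_max_right _ _)
      fun x => (hB i.1 x).trans (le_max_left _ _)
  rw [tendsto_pi_nhds] at hlim
  have hcau : ∀ t ∈ Icc 0 T, ∀ f : Phase d → ℝ, ContDiff ℝ ∞ f → HasCompactSupport f →
      CauchySeq fun k => ∫ x, f x ∂(m (σ k) t) := by
    intro t ht f hf hfc
    rw [Metric.cauchySeq_iff']
    intro δ hδ
    obtain ⟨j, hj⟩ := hφ3 f hf hfc (δ / 8) (by positivity)
    obtain ⟨C, hC⟩ := hLip (φ j) (hφ1 j) (hφ2 j)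
    have hC1 : 0 < |C| + 1 := by positivity
    obtain ⟨i, hi⟩ := hq.exists_dist_lt ⟨t, ht⟩ (ε := δ / 8 / (|C| + 1)) (by positivity)
    have hCi : C * |t - q i| ≤ δ / 8 := by
      rw [Subtype.dist_eq, Real.dist_eq] at hi
      calc C * |t - q i| ≤ (|C| + 1) * |t - q i| := by
            gcongr; linarith [le_abs_self C]
        _ ≤ (|C| + 1) * (δ / 8 / (|C| + 1)) := by gcongr
        _ = δ / 8 := by field_simp
    obtain ⟨N, hN⟩ := Metric.cauchySeq_iff'.1 (hlim (j, i)).cauchySeq (δ / 4) (by positivity)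
    refine ⟨N, fun n hn => ?_⟩
    have hN' := hN n hn
    have est : ∀ k, |∫ x, f x ∂(m (σ k) t) - ∫ x, φ j x ∂(m (σ k) (q i))| ≤ δ / 4 := by
      intro k
      have := isFiniteMeasure_of_le_one (hm (σ k) t ht)
      have e1 := abs_integral_sub_le_of_mass_le_one (hm (σ k) t ht) (by positivity)
        (hf.continuous.integrable_of_hasCompactSupport hfc)
        ((hφ1 j).continuous.integrable_of_hasCompactSupport (hφ2 j)) hj
      have e2 := hC (σ k) _ (q i).2 _ ht
      have := abs_sub_le (∫ x, f x ∂(m (σ k) t)) (∫ x, φ j x ∂(m (σ k) t))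
        (∫ x, φ j x ∂(m (σ k) (q i)))
      linarith
    have e1 := est n
    have e2 := est N
    simp only [Function.comp, a] at hN'
    rw [Real.dist_eq, abs_lt] at hN' ⊢
    rw [abs_le] at e1 e2
    constructor <;> linarith [hN'.1, hN'.2, e1.1, e1.2, e2.1, e2.2]
  have hex : ∀ t : ℝ, ∃ ν : Measure (Phase d), ν univ ≤ 1 ∧
      (t ∈ Icc 0 T → DistTendsto (fun k => m (σ k) t) atTop ν) := by
    intro t
    by_cases ht : t ∈ Icc 0 T
    · obtain ⟨ν, hν1, hν2⟩ := exists_measure_tendsto_ultrafilter (Ultrafilter.of atTop)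
        (μ := fun k => m (σ k) t) fun k => hm _ t ht
      refine ⟨ν, hν1, fun _ f hf hfc => ?_⟩
      obtain ⟨c, hc⟩ := cauchySeq_tendsto_of_complete (hcau t ht f hf hfc)
      have := tendsto_nhds_unique (hc.mono_left (Ultrafilter.of_le atTop))
        (hν2 f hf.continuous hfc)
      rwa [← this]
    · exact ⟨0, by simp, fun h => absurd h ht⟩
  choose ν hν1 hν2 using hex
  exact ⟨σ, hσ, ν, hν1, hν2⟩

/-! ### Flow of a locally Lipschitz field -/

namespace IsTrajectory

variable {d : ℕ} {v : Phase d → Phase d} {s s' : ℝ} {x : Phase d} {γ γ' : ℝ → Phase d}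

lemma continuousOn (h : IsTrajectory v s x γ) : ContinuousOn γ (Icc 0 s) :=
  fun r hr => (h.2 r hr).continuousWithinAt

lemma hasDerivWithinAt_Ici (h : IsTrajectory v s x γ) {r : ℝ} (hr : r ∈ Ico 0 s) :
    HasDerivWithinAt γ (v (γ r)) (Ici r) r :=
  (h.2 r ⟨hr.1, hr.2.le⟩).mono_of_mem_nhdsWithin
    (mem_of_superset (Icc_mem_nhdsGE hr.2) (Icc_subset_Icc_left hr.1))

lemma mono (h : IsTrajectory v s x γ) (hs : s' ≤ s) : IsTrajectory v s' x γ :=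
  ⟨h.1, fun r hr => (h.2 r ⟨hr.1, hr.2.trans hs⟩).mono (Icc_subset_Icc_right hs)⟩

lemma congr_field {v' : Phase d → Phase d} (h : IsTrajectory v s x γ)
    (hv : ∀ r ∈ Icc 0 s, v' (γ r) = v (γ r)) : IsTrajectory v' s x γ :=
  ⟨h.1, fun r hr => by rw [hv r hr]; exact h.2 r hr⟩

lemma exists_norm_le (h : IsTrajectory v s x γ) : ∃ N, 0 ≤ N ∧ ∀ r ∈ Icc 0 s, ‖γ r‖ ≤ N := by
  obtain ⟨N, hN⟩ := (isCompact_Icc.image_of_continuousOn h.continuousOn).isBounded.exists_norm_le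
  exact ⟨max N 0, le_max_right _ _, fun r hr =>
    (hN _ (mem_image_of_mem _ hr)).trans (le_max_left _ _)⟩

lemma eqOn (hv : LocallyLipschitz v) (h : IsTrajectory v s x γ) (h' : IsTrajectory v s x γ') :
    EqOn γ γ' (Icc 0 s) := by
  obtain ⟨K, hK⟩ := LocallyLipschitzOn.exists_lipschitzOnWith_of_compact
    ((isCompact_Icc.image_of_continuousOn h.continuousOn).union
      (isCompact_Icc.image_of_continuousOn h'.continuousOn)) hv.locallyLipschitzOn
  exact ODE_solution_unique_of_mem_Icc_right (v := fun _ => v) (fun _ _ => hK) h.continuousOn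
    (fun r hr => h.hasDerivWithinAt_Ici hr)
    (fun r hr => Or.inl (mem_image_of_mem _ (Ico_subset_Icc_self hr))) h'.continuousOn
    (fun r hr => h'.hasDerivWithinAt_Ici hr)
    (fun r hr => Or.inr (mem_image_of_mem _ (Ico_subset_Icc_self hr))) (h.1.trans h'.1.symm)

/-- Concatenation of a trajectory on `[0, s]` with one on `[0, s']` from its end point. -/
lemma concat (hs : 0 ≤ s) (hs' : 0 ≤ s') (h : IsTrajectory v s x γ)
    (h' : IsTrajectory v s' (γ s) γ') :
    IsTrajectory v (s + s') x fun r => if r ≤ s then γ r else γ' (r - s) := by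
  set η : ℝ → Phase d := fun r => if r ≤ s then γ r else γ' (r - s) with hη
  have h1 : EqOn η γ (Icc 0 s) := fun r hr => if_pos hr.2
  have h2 : EqOn η (fun r => γ' (r - s)) (Icc s (s + s')) := fun r hr => by
    rcases hr.1.eq_or_lt with rfl | hlt
    · simp [hη, h'.1]
    · exact if_neg (not_le.2 hlt)
  have d1 : ∀ r ∈ Icc 0 s, HasDerivWithinAt η (v (η r)) (Icc 0 s) r := fun r hr => by
    rw [h1 hr]; exact (h.2 r hr).congr h1 (h1 hr)
  have d2 : ∀ r ∈ Icc s (s + s'), HasDerivWithinAt η (v (η r)) (Icc s (s + s')) r := by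
    intro r hr
    rw [h2 hr]
    have hr' : r - s ∈ Icc 0 s' := ⟨by linarith [hr.1], by linarith [hr.2]⟩
    have hmaps : MapsTo (fun r => r - s) (Icc s (s + s')) (Icc 0 s') := fun y hy =>
      ⟨by linarith [hy.1], by linarith [hy.2]⟩
    have := (h'.2 _ hr').scomp r (((hasDerivAt_id r).sub_const s).hasDerivWithinAt
      (s := Icc s (s + s'))) hmaps
    rw [one_smul] at this
    exact this.congr h2 (h2 hr)
  refine ⟨by rw [h1 ⟨le_rfl, hs⟩, h.1], fun r hr => ?_⟩
  rcases lt_trichotomy r s with hlt | rfl | hgt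
  · refine (d1 r ⟨hr.1, hlt.le⟩).mono_of_mem_nhdsWithin ?_
    filter_upwards [self_mem_nhdsWithin, mem_nhdsWithin_of_mem_nhds (Iio_mem_nhds hlt)]
      with y hy hy'
    exact ⟨hy.1, le_of_lt hy'⟩
  · have := (d1 r ⟨hr.1, le_rfl⟩).union (d2 r ⟨le_rfl, hr.2⟩)
    rwa [Icc_union_Icc_eq_Icc hs (by linarith)] at this
  · refine (d2 r ⟨hgt.le, hr.2⟩).mono_of_mem_nhdsWithin ?_
    filter_upwards [self_mem_nhdsWithin, mem_nhdsWithin_of_mem_nhds (Ioi_mem_nhds hgt)]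
      with y hy hy'
    exact ⟨le_of_lt hy', hy.2⟩

end IsTrajectory

lemma trajectory_isTrajectory {d : ℕ} {v : Phase d → Phase d} {s : ℝ} {x : Phase d}
    (hx : x ∈ aliveSet v s) : IsTrajectory v s x (trajectory v s x) := by
  have h : ∃ γ, IsTrajectory v s x γ := hx
  rw [trajectory, dif_pos h]
  exact h.choose_spec

lemma trajectory_eqOn {d : ℕ} {v : Phase d → Phase d} (hv : LocallyLipschitz v) {s s' : ℝ}
    (hs : s' ≤ s) {x : Phase d} {γ : ℝ → Phase d} (h : IsTrajectory v s x γ) :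
    EqOn (trajectory v s' x) γ (Icc 0 s') :=
  (trajectory_isTrajectory ⟨γ, h.mono hs⟩).eqOn hv (h.mono hs)

lemma aliveSet_anti {d : ℕ} (v : Phase d → Phase d) : Antitone (aliveSet v) :=
  fun _ _ hs _ ⟨γ, h⟩ => ⟨γ, h.mono hs⟩

/-- Clamping every coordinate to `[-N, N]` is a Lipschitz retraction onto a bounded set; composing
with it turns a locally Lipschitz field into a bounded, globally Lipschitz one. -/
lemma exists_truncation {d : ℕ} {v : Phase d → Phase d} (hv : LocallyLipschitz v) {N : ℝ}
    (hN : 0 ≤ N) : ∃ (V : Phase d → Phase d) (K L : NNReal), LipschitzWith K V ∧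
      (∀ x, ‖V x‖ ≤ L) ∧ ∀ x, ‖x‖ ≤ N → V x = v x := by
  let c : Phase d → Phase d := fun x => WithLp.toLp 2 fun i => max (-N) (min N (x i))
  have hc : LipschitzWith 1 c := by
    refine LipschitzWith.of_dist_le_mul fun x y => ?_
    rw [NNReal.coe_one, one_mul, EuclideanSpace.dist_eq, EuclideanSpace.dist_eq]
    refine Real.sqrt_le_sqrt (Finset.sum_le_sum fun i _ => ?_)
    refine pow_le_pow_left₀ dist_nonneg ?_ 2
    rw [Real.dist_eq, Real.dist_eq]
    show |max (-N) (min N (x i)) - max (-N) (min N (y i))| ≤ |x i - y i|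
    calc _ ≤ |min N (x i) - min N (y i)| := by
          rw [max_comm, max_comm (-N)]; exact abs_max_sub_max_le_abs _ _ _
      _ ≤ max |N - N| |x i - y i| := abs_min_sub_min_le_max _ _ _ _
      _ = |x i - y i| := by simp
  have hcN : ∀ x, ‖x‖ ≤ N → c x = x := fun x hx => by
    ext i
    have hi : |x i| ≤ N := by
      have := PiLp.norm_apply_le x i
      exact this.trans hx
    show max (-N) (min N (x i)) = x i
    rw [min_eq_right (abs_le.1 hi).2, max_eq_right (abs_le.1 hi).1]
  have hcb : ∃ M, ∀ x, ‖c x‖ ≤ M := by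
    refine ⟨√(∑ _i : Fin d ⊕ Fin d, N ^ 2), fun x => ?_⟩
    rw [EuclideanSpace.norm_eq]
    refine Real.sqrt_le_sqrt (Finset.sum_le_sum fun i _ => ?_)
    refine pow_le_pow_left₀ (norm_nonneg _) ?_ 2
    show |max (-N) (min N (x i))| ≤ N
    exact abs_le.2 ⟨le_max_left _ _, max_le (by linarith) (min_le_left _ _)⟩
  obtain ⟨M, hM⟩ := hcb
  have hKc := isCompact_closedBall (0 : Phase d) M
  obtain ⟨K, hK⟩ := LocallyLipschitzOn.exists_lipschitzOnWith_of_compact hKc hv.locallyLipschitzOn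
  obtain ⟨L, hL⟩ := hKc.exists_bound_of_continuousOn hv.continuous.continuousOn
  have hmem : ∀ x, c x ∈ Metric.closedBall (0 : Phase d) M := fun x => by simpa using hM x
  refine ⟨v ∘ c, K * 1, L.toNNReal, ?_, fun x => (hL _ (hmem x)).trans (Real.le_coe_toNNReal L),
    fun x hx => by simp [hcN x hx]⟩
  rw [← lipschitzOnWith_univ]
  exact hK.comp hc.lipschitzOnWith fun x _ => hmem x

lemma exists_isTrajectory_of_bounded {d : ℕ} {V : Phase d → Phase d} {K L : NNReal}
    (hV : LipschitzWith K V) (hL : ∀ x, ‖V x‖ ≤ L) {S : ℝ} (hS : 0 ≤ S) (x : Phase d) :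
    ∃ γ, IsTrajectory V S x γ := by
  have hpl : IsPicardLindelof (fun _ => V) (tmin := 0) (tmax := S) ⟨0, le_rfl, hS⟩ x
      (L * S.toNNReal) 0 L K :=
    ⟨fun _ _ => hV.lipschitzOnWith, fun _ _ => continuousOn_const, fun _ _ y _ => hL y, by
      simp [hS]⟩
  obtain ⟨γ, h0, h1⟩ := hpl.exists_eq_forall_mem_Icc_hasDerivWithinAt₀
  exact ⟨γ, h0, h1⟩

lemma IsTrajectory.dist_le {d : ℕ} {V : Phase d → Phase d} {K : NNReal}
    (hV : LipschitzWith K V) {S : ℝ} {x y : Phase d} {γ η : ℝ → Phase d}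
    (h : IsTrajectory V S x γ) (h' : IsTrajectory V S y η) {r : ℝ} (hr : r ∈ Icc 0 S) :
    dist (γ r) (η r) ≤ dist x y * Real.exp (K * S) := by
  have := dist_le_of_trajectories_ODE (v := fun _ => V) (δ := dist x y) (fun _ => hV) h.continuousOn
    (fun t ht => h.hasDerivWithinAt_Ici ht) h'.continuousOn
    (fun t ht => h'.hasDerivWithinAt_Ici ht) (by rw [h.1, h'.1]) r hr
  refine this.trans ?_
  gcongr
  simpa using hr.2

/-- Trajectories that are alive at time `s` are stable under perturbation of the initial point. -/
lemma exists_ball_subset_aliveSet {d : ℕ} {v : Phase d → Phase d} (hv : LocallyLipschitz v) {s : ℝ}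
    (hs : 0 ≤ s) {x : Phase d} (hx : x ∈ aliveSet v s) : ∃ δ > 0, ∃ C : ℝ, 0 ≤ C ∧
      ∀ y ∈ Metric.ball x δ, y ∈ aliveSet v s ∧ ∀ r ∈ Icc 0 s,
        dist (trajectory v s y r) (trajectory v s x r) ≤ C * dist y x ∧
        dist (v (trajectory v s y r)) (v (trajectory v s x r)) ≤ C * dist y x := by
  have hγ := trajectory_isTrajectory hx
  set γ := trajectory v s x
  obtain ⟨N, hN0, hN⟩ := hγ.exists_norm_le
  obtain ⟨V, K, L, hV, hL, hVv⟩ := exists_truncation hv (N := N + 1) (by linarith)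
  have hγV : IsTrajectory V s x γ := hγ.congr_field fun r hr => hVv _ (by linarith [hN r hr])
  set C := Real.exp (K * s)
  have hC : 0 < C := Real.exp_pos _
  refine ⟨1 / C, by positivity, C + K * C, by positivity, fun y hy => ?_⟩
  obtain ⟨η, hη⟩ := exists_isTrajectory_of_bounded hV hL hs y
  have hd : ∀ r ∈ Icc 0 s, dist (η r) (γ r) ≤ dist y x * C := fun r hr => hη.dist_le hV hγV hr
  have hy1 : dist y x * C < 1 := by
    rw [Metric.mem_ball, lt_div_iff₀ hC] at hy; exact hy
  have hηN : ∀ r ∈ Icc 0 s, ‖η r‖ ≤ N + 1 := fun r hr => by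
    have h1 := hd r hr
    have h2 := hN r hr
    rw [dist_eq_norm] at h1
    have h3 := norm_sub_norm_le (η r) (γ r)
    linarith
  have hηv : IsTrajectory v s y η := hη.congr_field fun r hr => (hVv _ (hηN r hr)).symm
  refine ⟨⟨η, hηv⟩, fun r hr => ?_⟩
  rw [trajectory_eqOn hv le_rfl hηv hr, ← hVv _ (hηN r hr),
    ← hVv (γ r) (by linarith [hN r hr])]
  have hd0 : 0 ≤ dist y x := dist_nonneg
  have hKC : 0 ≤ (K : ℝ) * C * dist y x := by positivity
  have h1 := hd r hr
  constructor
  · nlinarith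
  · calc _ ≤ K * dist (η r) (γ r) := hV.dist_le_mul _ _
      _ ≤ K * (dist y x * C) := by gcongr
      _ ≤ _ := by nlinarith [mul_nonneg hC.le hd0]

lemma isOpen_aliveSet {d : ℕ} {v : Phase d → Phase d} (hv : LocallyLipschitz v) {s : ℝ}
    (hs : 0 ≤ s) : IsOpen (aliveSet v s) := by
  rw [Metric.isOpen_iff]
  intro x hx
  obtain ⟨δ, hδ, C, -, h⟩ := exists_ball_subset_aliveSet hv hs hx
  exact ⟨δ, hδ, fun y hy => (h y hy).1⟩

lemma continuousOn_trajectory {d : ℕ} {v : Phase d → Phase d} (hv : LocallyLipschitz v) {s : ℝ}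
    {r : ℝ} (hr : r ∈ Icc 0 s) :
    ContinuousOn (fun x => trajectory v s x r) (aliveSet v s) := by
  intro x hx
  obtain ⟨δ, hδ, C, hC, h⟩ := exists_ball_subset_aliveSet hv (hr.1.trans hr.2) hx
  refine ContinuousAt.continuousWithinAt ?_
  refine continuousAt_of_locally_lipschitz hδ C fun y hy => ?_
  exact ((h y hy).2 r hr).1

lemma intervalIntegrable_norm_field {d : ℕ} {v : Phase d → Phase d} (hv : Continuous v) {s : ℝ}
    (hs : 0 ≤ s) {x : Phase d} {γ : ℝ → Phase d} (h : IsTrajectory v s x γ) :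
    IntervalIntegrable (fun r => ‖v (γ r)‖) volume 0 s := by
  refine ContinuousOn.intervalIntegrable ?_
  rw [uIcc_of_le hs]
  exact (hv.comp_continuousOn h.continuousOn).norm

lemma continuousOn_massFactor {d : ℕ} {v : Phase d → Phase d} (hv : LocallyLipschitz v) {s : ℝ}
    (hs : 0 ≤ s) (ε : ℝ) : ContinuousOn (massFactor ε v s) (aliveSet v s) := by
  have key : ContinuousOn (fun x => ∫ r in (0 : ℝ)..s, ‖v (trajectory v s x r)‖)
      (aliveSet v s) := by
    intro x hx
    obtain ⟨δ, hδ, C, hC, h⟩ := exists_ball_subset_aliveSet hv hs hx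
    refine ContinuousAt.continuousWithinAt ?_
    refine continuousAt_of_locally_lipschitz hδ (C * s) fun y hy => ?_
    rw [Real.dist_eq, ← intervalIntegral.integral_sub
      (intervalIntegrable_norm_field hv.continuous hs (trajectory_isTrajectory (h y hy).1))
      (intervalIntegrable_norm_field hv.continuous hs (trajectory_isTrajectory hx))]
    have := intervalIntegral.norm_integral_le_of_norm_le_const (a := (0 : ℝ)) (b := s)
      (C := C * dist y x)
      (f := fun r => ‖v (trajectory v s y r)‖ - ‖v (trajectory v s x r)‖) fun r hr => by
        rw [uIoc_of_le hs] at hr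
        refine (abs_norm_sub_norm_le _ _).trans ?_
        rw [← dist_eq_norm]
        exact ((h y hy).2 r ⟨hr.1.le, hr.2⟩).2
    rw [sub_zero, abs_of_nonneg hs, Real.norm_eq_abs] at this
    linarith
  exact Real.continuous_exp.comp_continuousOn (key.const_mul ε).neg

/-- On a bounded set of initial points the time of existence is bounded below. -/
lemma exists_gt_mem_aliveSet {d : ℕ} {v : Phase d → Phase d} (hv : LocallyLipschitz v) {N : ℝ}
    (hN : 0 ≤ N) : ∃ δ > 0, ∀ y : Phase d, ‖y‖ ≤ N → y ∈ aliveSet v δ := by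
  obtain ⟨V, K, L, hV, hL, hVv⟩ := exists_truncation hv (N := N + 1) (by linarith)
  have hL0 : (0 : ℝ) < L + 1 := by positivity
  refine ⟨1 / (L + 1), by positivity, fun y hy => ?_⟩
  obtain ⟨η, hη⟩ := exists_isTrajectory_of_bounded hV hL (S := 1 / (L + 1)) (by positivity) y
  refine ⟨η, hη.congr_field fun r hr => (hVv _ ?_).symm⟩
  have h1 := norm_image_sub_le_of_norm_deriv_right_le_segment hη.continuousOn
    (fun r hr => hη.hasDerivWithinAt_Ici hr) (fun r _ => hL _) r hr
  have h2 : (L : ℝ) * (r - 0) ≤ 1 := by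
    calc (L : ℝ) * (r - 0) ≤ (L + 1) * (1 / (L + 1)) := by
          have := hr.2
          have := hr.1
          rw [sub_zero]
          gcongr
          linarith
      _ = 1 := by field_simp
  rw [hη.1] at h1
  have h3 := norm_sub_norm_le (η r) y
  linarith

lemma mem_aliveSet_concat {d : ℕ} {v : Phase d → Phase d} {s s' : ℝ} (hs : 0 ≤ s) (hs' : 0 ≤ s')
    {x : Phase d} (hx : x ∈ aliveSet v s) (hx' : trajectory v s x s ∈ aliveSet v s') :
    x ∈ aliveSet v (s + s') :=
  ⟨_, (trajectory_isTrajectory hx).concat hs hs' (trajectory_isTrajectory hx')⟩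

lemma aliveSet_extends {d : ℕ} {v : Phase d → Phase d} (hv : LocallyLipschitz v) {s : ℝ}
    (hs : 0 ≤ s) {x : Phase d} (hx : x ∈ aliveSet v s) : ∃ s' > s, x ∈ aliveSet v s' := by
  obtain ⟨δ, hδ, h⟩ := exists_gt_mem_aliveSet hv (norm_nonneg (trajectory v s x s))
  exact ⟨s + δ, by linarith, mem_aliveSet_concat hs hδ.le hx (h _ le_rfl)⟩

/-- A trajectory that ceases to exist leaves every bounded set before its final time. -/
lemma exists_forall_lt_norm_trajectory {d : ℕ} {v : Phase d → Phase d} (hv : LocallyLipschitz v)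
    {τ : ℝ} {x : Phase d} (hx : x ∉ aliveSet v τ) {N : ℝ} (hN : 0 ≤ N) :
    ∃ τ' < τ, ∀ r, 0 ≤ r → τ' < r → x ∈ aliveSet v r → N < ‖trajectory v r x r‖ := by
  obtain ⟨δ, hδ, h⟩ := exists_gt_mem_aliveSet hv hN
  refine ⟨τ - δ, by linarith, fun r hr0 hr hxr => ?_⟩
  by_contra hcon
  have := mem_aliveSet_concat hr0 hδ.le hxr (h _ (not_lt.1 hcon))
  exact hx (aliveSet_anti v (by linarith) this)

lemma aliveSet_zero {d : ℕ} (v : Phase d → Phase d) : aliveSet v 0 = univ := by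
  refine eq_univ_of_forall fun x => ⟨fun _ => x, rfl, fun r hr => ?_⟩
  rw [Icc_self] at hr ⊢
  rw [mem_singleton_iff.1 hr]
  rw [hasDerivWithinAt_iff_hasFDerivWithinAt]
  exact HasFDerivWithinAt.singleton

/-! ### The deficient evolution with a frozen field -/

/-- The operator `φ ↦ ∂ₜφ + ⟨v, ∇φ⟩ - ε |v| φ` dual to the deficient continuity equation with
field `v`. -/
noncomputable def deficientGenerator {d : ℕ} (ε : ℝ) (v : Phase d → Phase d) (φ : ℝ × Phase d → ℝ)
    (z : ℝ × Phase d) : ℝ :=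
  fderiv ℝ φ z (1, 0) + fderiv ℝ φ z (0, v z.2) - ε * ‖v z.2‖ * φ z

/-- The function `R_s ψ(s, ·) ∘ X_s` on `𝕊_s`, extended by zero, whose `μ`-integral is the integral
of `ψ(s, ·)` against the deficient evolution of `μ` at time `s`. -/
noncomputable def transported {d : ℕ} (ε : ℝ) (v : Phase d → Phase d) (ψ : ℝ × Phase d → ℝ) (s : ℝ)
    (x : Phase d) : ℝ :=
  (aliveSet v s).indicator (fun x => massFactor ε v s x * ψ (s, trajectory v s x s)) x

lemma massFactor_pos {d : ℕ} (ε : ℝ) (v : Phase d → Phase d) (s : ℝ) (x : Phase d) :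
    0 < massFactor ε v s x :=
  Real.exp_pos _

lemma massFactor_le_one {d : ℕ} {ε : ℝ} (hε : 0 ≤ ε) (v : Phase d → Phase d) {s : ℝ} (hs : 0 ≤ s)
    (x : Phase d) : massFactor ε v s x ≤ 1 := by
  rw [massFactor, Real.exp_le_one_iff, neg_nonpos]
  exact mul_nonneg hε (intervalIntegral.integral_nonneg hs fun _ _ => norm_nonneg _)

lemma continuous_deficientGenerator {d : ℕ} (ε : ℝ) {v : Phase d → Phase d} (hv : Continuous v)
    {φ : ℝ × Phase d → ℝ} (hφ : ContDiff ℝ 1 φ) : Continuous (deficientGenerator ε v φ) := by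
  have h1 : Continuous (fderiv ℝ φ) := hφ.continuous_fderiv (by norm_num)
  have h2 := hφ.continuous
  unfold deficientGenerator
  fun_prop

lemma deficientGenerator_eq_zero {d : ℕ} (ε : ℝ) (v : Phase d → Phase d) {φ : ℝ × Phase d → ℝ}
    {K : Set (Phase d)} (hK : IsClosed K) (hφK : ∀ t x, x ∉ K → φ (t, x) = 0) (t : ℝ) {x : Phase d}
    (hx : x ∉ K) : deficientGenerator ε v φ (t, x) = 0 := by
  have h0 : φ =ᶠ[𝓝 (t, x)] fun _ => 0 := by
    have : {z : ℝ × Phase d | z.2 ∈ Kᶜ} ∈ 𝓝 (t, x) :=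
      (hK.isOpen_compl.preimage continuous_snd).mem_nhds hx
    filter_upwards [this] with z hz
    exact hφK z.1 z.2 hz
  have h1 : fderiv ℝ φ (t, x) = 0 := by rw [h0.fderiv_eq]; simp
  simp [deficientGenerator, h1, hφK t x hx]

section Evolution

variable {d : ℕ} {v : Phase d → Phase d} {ε s : ℝ} {μ : Measure (Phase d)}

lemma aemeasurable_trajectory (hv : LocallyLipschitz v) (hs : 0 ≤ s) (ε : ℝ)
    (μ : Measure (Phase d)) :
    AEMeasurable (fun x => trajectory v s x s)
      ((μ.restrict (aliveSet v s)).withDensity fun x => ENNReal.ofReal (massFactor ε v s x)) :=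
  ((continuousOn_trajectory hv ⟨hs, le_rfl⟩).aemeasurable
    (isOpen_aliveSet hv hs).measurableSet).mono_ac (withDensity_absolutelyContinuous _ _)

lemma integral_deficientEvolution (hv : LocallyLipschitz v) (hs : 0 ≤ s) (ε : ℝ)
    (μ : Measure (Phase d)) {ψ : ℝ × Phase d → ℝ} (hψ : Continuous ψ) :
    ∫ x, ψ (s, x) ∂(deficientEvolution ε v s μ) = ∫ x, transported ε v ψ s x ∂μ := by
  have hmeas := (isOpen_aliveSet hv hs).measurableSet
  have hψs : Continuous fun x => ψ (s, x) := by fun_prop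
  rw [deficientEvolution, integral_map (aemeasurable_trajectory hv hs ε μ)
    hψs.aestronglyMeasurable, integral_withDensity_eq_integral_toReal_smul₀
    ((continuousOn_massFactor hv hs ε).aemeasurable hmeas).ennreal_ofReal
    (Eventually.of_forall fun _ => ENNReal.ofReal_lt_top)]
  unfold transported
  rw [integral_indicator hmeas]
  refine integral_congr_ae (Eventually.of_forall fun x => ?_)
  simp only [smul_eq_mul]
  rw [ENNReal.toReal_ofReal (massFactor_pos ε v s x).le]

/-- The evolution only loses mass along the flow: it gives to `S` at most the initial mass of the
points whose trajectory ends in `S`. -/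
lemma deficientEvolution_apply_le (hv : LocallyLipschitz v) (hs : 0 ≤ s) (hε : 0 ≤ ε)
    {S A : Set (Phase d)} (hS : MeasurableSet S)
    (hA : ∀ x ∈ aliveSet v s, trajectory v s x s ∈ S → x ∈ A) :
    deficientEvolution ε v s μ S ≤ μ A := by
  rw [deficientEvolution, Measure.map_apply_of_aemeasurable (aemeasurable_trajectory hv hs ε μ) hS]
  have hle : (μ.restrict (aliveSet v s)).withDensity
      (fun x => ENNReal.ofReal (massFactor ε v s x)) ≤ μ.restrict (aliveSet v s) := by
    conv_rhs => rw [← withDensity_one (μ := μ.restrict (aliveSet v s))]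
    refine withDensity_mono (Eventually.of_forall fun x => ?_)
    exact ENNReal.ofReal_le_one.2 (massFactor_le_one hε v hs x)
  refine (hle _).trans ?_
  rw [Measure.restrict_apply' (isOpen_aliveSet hv hs).measurableSet]
  exact measure_mono fun x hx => hA x hx.2 hx.1

lemma deficientEvolution_univ_le (hv : LocallyLipschitz v) (hs : 0 ≤ s) (hε : 0 ≤ ε) :
    deficientEvolution ε v s μ univ ≤ μ univ :=
  deficientEvolution_apply_le hv hs hε MeasurableSet.univ fun x _ _ => mem_univ x

lemma deficientEvolution_zero (v : Phase d → Phase d) (ε : ℝ) (μ : Measure (Phase d)) :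
    deficientEvolution ε v 0 μ = μ := by
  have h1 : (fun x => trajectory v 0 x 0) = id := by
    funext x
    exact (trajectory_isTrajectory (by rw [aliveSet_zero]; trivial)).1
  have h2 : (fun x => ENNReal.ofReal (massFactor ε v 0 x)) = 1 := by
    funext x
    simp [massFactor]
  rw [deficientEvolution, h1, h2, aliveSet_zero, Measure.restrict_univ, withDensity_one,
    Measure.map_id]

lemma aestronglyMeasurable_transported (hv : LocallyLipschitz v) (hs : 0 ≤ s) (ε : ℝ)
    {ψ : ℝ × Phase d → ℝ} (hψ : Continuous ψ) :
    AEStronglyMeasurable (transported ε v ψ s) μ := by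
  have hmeas := (isOpen_aliveSet hv hs).measurableSet
  have : ContinuousOn (fun x => massFactor ε v s x * ψ (s, trajectory v s x s)) (aliveSet v s) :=
    (continuousOn_massFactor hv hs ε).mul (hψ.comp_continuousOn
      (continuousOn_const.prodMk (continuousOn_trajectory hv ⟨hs, le_rfl⟩)))
  exact (aestronglyMeasurable_indicator_iff hmeas).2 (this.aestronglyMeasurable hmeas)

lemma abs_transported_le (hε : 0 ≤ ε) (hs : 0 ≤ s) {ψ : ℝ × Phase d → ℝ} {C : ℝ} (hC : 0 ≤ C)
    (hψ : ∀ x, |ψ (s, x)| ≤ C) (x : Phase d) : |transported ε v ψ s x| ≤ C := by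
  by_cases hx : x ∈ aliveSet v s
  · rw [transported, indicator_of_mem hx, abs_mul, abs_of_pos (massFactor_pos ε v s x)]
    calc _ ≤ 1 * C := mul_le_mul (massFactor_le_one hε v hs x) (hψ _) (abs_nonneg _) zero_le_one
      _ = C := one_mul C
  · rw [transported, indicator_of_notMem hx, abs_zero]
    exact hC

/-- Along a trajectory alive on `[0, s']`, the transported test function is differentiable and its
derivative is the transported generator. -/
lemma hasDerivWithinAt_transported_Icc (hv : LocallyLipschitz v) (ε : ℝ) {φ : ℝ × Phase d → ℝ}
    (hφ : ContDiff ℝ 1 φ) {s' : ℝ} {x : Phase d} (hx : x ∈ aliveSet v s') {r : ℝ}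
    (hr : r ∈ Icc 0 s') :
    HasDerivWithinAt (fun s => transported ε v φ s x)
      (transported ε v (deficientGenerator ε v φ) r x) (Icc 0 s') r := by
  have hs' : 0 ≤ s' := hr.1.trans hr.2
  have hγ := trajectory_isTrajectory hx
  set γ := trajectory v s' x
  -- Extending the trajectory constantly beyond `[0, s']` makes the integrand continuous on `ℝ`.
  have hform : ∀ (ψ : ℝ × Phase d → ℝ), ∀ t ∈ Icc 0 s', transported ε v ψ t x =
      Real.exp (-(ε * ∫ r in (0 : ℝ)..t, ‖v (IccExtend hs' (fun y => γ y) r)‖)) * ψ (t, γ t) := by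
    intro ψ t ht
    have htraj : EqOn (trajectory v t x) γ (Icc 0 t) := trajectory_eqOn hv ht.2 hγ
    rw [transported, indicator_of_mem (aliveSet_anti v ht.2 hx), massFactor,
      htraj ⟨ht.1, le_rfl⟩]
    congr 4
    refine intervalIntegral.integral_congr fun y hy => ?_
    rw [uIcc_of_le ht.1] at hy
    have hy' : y ∈ Icc 0 s' := ⟨hy.1, hy.2.trans ht.2⟩
    simp only [IccExtend_of_mem hs' (fun y : Icc 0 s' => γ y) hy', htraj hy]
  have hcont : Continuous fun r => ‖v (IccExtend hs' (fun y => γ y) r)‖ :=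
    (hv.continuous.comp (hγ.continuousOn.domRestrict.Icc_extend' (h := hs'))).norm
  have hI : HasDerivAt (fun t => ∫ r in (0 : ℝ)..t, ‖v (IccExtend hs' (fun y => γ y) r)‖)
      ‖v (γ r)‖ r := by
    have := (hcont.integral_hasStrictDerivAt 0 r).hasDerivAt
    rwa [IccExtend_of_mem hs' (fun y : Icc 0 s' => γ y) hr] at this
  have hE := ((hI.const_mul ε).neg.exp).hasDerivWithinAt (s := Icc 0 s')
  have hφd : HasDerivWithinAt (fun t => φ (t, γ t)) (fderiv ℝ φ (r, γ r) (1, v (γ r)))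
      (Icc 0 s') r :=
    ((hφ.differentiable (by norm_num)) (r, γ r)).hasFDerivAt.comp_hasDerivWithinAt r
      ((hasDerivWithinAt_id r _).prodMk (hγ.2 r hr))
  rw [hform _ r hr]
  refine ((hE.mul hφd).congr (hform φ) (hform φ r hr)).congr_deriv ?_
  have hsplit : ((1 : ℝ), v (γ r)) = (1, 0) + (0, v (γ r)) := by simp
  rw [hsplit, map_add, deficientGenerator]
  simp only [Pi.neg_apply]
  ring

lemma hasDerivWithinAt_transported (hv : LocallyLipschitz v) (ε : ℝ) {φ : ℝ × Phase d → ℝ}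
    (hφ : ContDiff ℝ 1 φ) (hs : 0 ≤ s) (x : Phase d) :
    HasDerivWithinAt (fun s => transported ε v φ s x)
      (transported ε v (deficientGenerator ε v φ) s x) (Ici s) s := by
  by_cases hx : x ∈ aliveSet v s
  · obtain ⟨s', hs', hx'⟩ := aliveSet_extends hv hs hx
    refine (hasDerivWithinAt_transported_Icc hv ε hφ hx' ⟨hs, hs'.le⟩).mono_of_mem_nhdsWithin ?_
    exact mem_of_superset (Icc_mem_nhdsGE hs') (Icc_subset_Icc_left hs)
  · have h0 : ∀ ψ : ℝ × Phase d → ℝ, ∀ t ∈ Ici s, transported ε v ψ t x = 0 := fun ψ t ht =>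
      indicator_of_notMem (fun h => hx (aliveSet_anti v ht h)) _
    rw [h0 _ s self_mem_Ici]
    exact (hasDerivWithinAt_const s _ (0 : ℝ)).congr (h0 φ) (h0 φ s self_mem_Ici)

/-- The transported test function is continuous in time, also at the time when the trajectory
ceases to exist, because the trajectory has left the support of `φ` before. -/
lemma continuousOn_transported (hv : LocallyLipschitz v) (ε : ℝ) {φ : ℝ × Phase d → ℝ}
    (hφ : ContDiff ℝ 1 φ) {K : Set (Phase d)} (hK : IsCompact K)
    (hφK : ∀ t x, x ∉ K → φ (t, x) = 0) (x : Phase d) :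
    ContinuousOn (fun s => transported ε v φ s x) (Ici 0) := by
  intro s hs
  by_cases hx : x ∈ aliveSet v s
  · obtain ⟨s', hs', hx'⟩ := aliveSet_extends hv hs hx
    refine (hasDerivWithinAt_transported_Icc hv ε hφ hx'
      ⟨hs, hs'.le⟩).continuousWithinAt.mono_of_mem_nhdsWithin ?_
    filter_upwards [self_mem_nhdsWithin, mem_nhdsWithin_of_mem_nhds (Iio_mem_nhds hs')] with y h1 h2
    exact ⟨h1, le_of_lt h2⟩
  · obtain ⟨N, hN⟩ := hK.isBounded.exists_norm_le
    obtain ⟨τ, hτ, h⟩ := exists_forall_lt_norm_trajectory hv hx (le_max_right N 0)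
    have h0 : (fun s => transported ε v φ s x) =ᶠ[𝓝[Ici 0] s] fun _ => 0 := by
      filter_upwards [self_mem_nhdsWithin, mem_nhdsWithin_of_mem_nhds (Ioi_mem_nhds hτ)]
        with r h1 h2
      by_cases hxr : x ∈ aliveSet v r
      · rw [transported, indicator_of_mem hxr, hφK _ _ fun hmem => ?_, mul_zero]
        exact absurd ((hN _ hmem).trans (le_max_left _ _)) (not_le.2 (h r h1 h2 hxr))
      · exact indicator_of_notMem hxr _
    exact continuousWithinAt_const.congr_of_eventuallyEq h0 (indicator_of_notMem hx _)

lemma abs_transported_sub_le (hv : LocallyLipschitz v) (hε : 0 ≤ ε) {φ : ℝ × Phase d → ℝ}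
    (hφ : ContDiff ℝ 1 φ) {K : Set (Phase d)} (hK : IsCompact K)
    (hφK : ∀ t x, x ∉ K → φ (t, x) = 0) {S C : ℝ} (hC : 0 ≤ C)
    (hgen : ∀ t ∈ Icc 0 S, ∀ x, |deficientGenerator ε v φ (t, x)| ≤ C) {s s' : ℝ} (hs : 0 ≤ s)
    (hss' : s ≤ s') (hs' : s' ≤ S) (x : Phase d) :
    |transported ε v φ s' x - transported ε v φ s x| ≤ C * (s' - s) := by
  have hsub : Icc s s' ⊆ Ici (0 : ℝ) := fun y hy => hs.trans hy.1
  exact norm_image_sub_le_of_norm_deriv_right_le_segment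
    ((continuousOn_transported hv ε hφ hK hφK x).mono hsub)
    (fun r hr => hasDerivWithinAt_transported hv ε hφ (hs.trans hr.1) x)
    (fun r hr => abs_transported_le hε (hs.trans hr.1) hC
      (hgen r ⟨hs.trans hr.1, hr.2.le.trans hs'⟩) x) s' ⟨hss', le_rfl⟩

lemma integrable_transported [IsFiniteMeasure μ] (hv : LocallyLipschitz v) (hs : 0 ≤ s)
    (hε : 0 ≤ ε) {ψ : ℝ × Phase d → ℝ} (hψ : Continuous ψ) {K : Set (Phase d)} (hK : IsCompact K)
    (hψK : ∀ t x, x ∉ K → ψ (t, x) = 0) : Integrable (transported ε v ψ s) μ := by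
  have hcs : HasCompactSupport fun x => ψ (s, x) := HasCompactSupport.intro hK (hψK s)
  have hcont : Continuous fun x => ψ (s, x) := by fun_prop
  obtain ⟨C, hC⟩ := hcont.bounded_above_of_compact_support hcs
  exact Integrable.of_bound (aestronglyMeasurable_transported hv hs ε hψ) (max C 0)
    (Eventually.of_forall fun x => abs_transported_le hε hs (le_max_right _ _)
      (fun y => (hC y).trans (le_max_left _ _)) x)

lemma abs_integral_deficientEvolution_sub_le (hμ : μ univ ≤ 1) (hv : LocallyLipschitz v)
    (hε : 0 ≤ ε) {φ : ℝ × Phase d → ℝ} (hφ : ContDiff ℝ 1 φ) {K : Set (Phase d)} (hK : IsCompact K)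
    (hφK : ∀ t x, x ∉ K → φ (t, x) = 0) {S C : ℝ} (hC : 0 ≤ C)
    (hgen : ∀ t ∈ Icc 0 S, ∀ x, |deficientGenerator ε v φ (t, x)| ≤ C) {s s' : ℝ} (hs : 0 ≤ s)
    (hss' : s ≤ s') (hs' : s' ≤ S) :
    |∫ x, φ (s', x) ∂(deficientEvolution ε v s' μ) - ∫ x, φ (s, x) ∂(deficientEvolution ε v s μ)|
      ≤ C * (s' - s) := by
  have := isFiniteMeasure_of_le_one hμ
  rw [integral_deficientEvolution hv (hs.trans hss') ε μ hφ.continuous,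
    integral_deficientEvolution hv hs ε μ hφ.continuous]
  exact abs_integral_sub_le_of_mass_le_one hμ (mul_nonneg hC (by linarith))
    (integrable_transported hv (hs.trans hss') hε hφ.continuous hK hφK)
    (integrable_transported hv hs hε hφ.continuous hK hφK)
    (abs_transported_sub_le hv hε hφ hK hφK hC hgen hs hss' hs')

/-- Weak form of the deficient continuity equation, as a right derivative in time. -/
lemma hasDerivWithinAt_integral_deficientEvolution (hμ : μ univ ≤ 1) (hv : LocallyLipschitz v)
    (hε : 0 ≤ ε) {φ : ℝ × Phase d → ℝ} (hφ : ContDiff ℝ 1 φ) {K : Set (Phase d)} (hK : IsCompact K)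
    (hφK : ∀ t x, x ∉ K → φ (t, x) = 0) {S C : ℝ} (hC : 0 ≤ C)
    (hgen : ∀ t ∈ Icc 0 S, ∀ x, |deficientGenerator ε v φ (t, x)| ≤ C) (hs : 0 ≤ s) (hsS : s < S) :
    HasDerivWithinAt (fun s => ∫ x, φ (s, x) ∂(deficientEvolution ε v s μ))
      (∫ x, deficientGenerator ε v φ (s, x) ∂(deficientEvolution ε v s μ)) (Ici s) s := by
  have := isFiniteMeasure_of_le_one hμ
  rw [← hasDerivWithinAt_Ioi_iff_Ici, hasDerivWithinAt_iff_tendsto_slope' self_notMem_Ioi,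
    integral_deficientEvolution hv hs ε μ (continuous_deficientGenerator ε hv.continuous hφ)]
  have hmem : Ioc s S ∈ 𝓝[>] s := Ioc_mem_nhdsGT hsS
  have hint : ∀ r, 0 ≤ r → Integrable (transported ε v φ r) μ := fun r hr =>
    integrable_transported hv hr hε hφ.continuous hK hφK
  have heq : (slope (fun s => ∫ x, φ (s, x) ∂(deficientEvolution ε v s μ)) s) =ᶠ[𝓝[>] s]
      fun r => ∫ x, slope (fun s => transported ε v φ s x) s r ∂μ := by
    filter_upwards [hmem] with r hr
    simp only [slope_def_field]
    rw [integral_div, integral_sub (hint r (hs.trans hr.1.le)) (hint s hs),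
      integral_deficientEvolution hv (hs.trans hr.1.le) ε μ hφ.continuous,
      integral_deficientEvolution hv hs ε μ hφ.continuous]
  refine Tendsto.congr' heq.symm ?_
  refine tendsto_integral_filter_of_dominated_convergence (fun _ => C) ?_ ?_
    (integrable_const C) (Eventually.of_forall fun x => ?_)
  · filter_upwards [hmem] with r hr
    simp only [slope_def_field]
    exact (((hint r (hs.trans hr.1.le)).sub (hint s hs)).div_const _).aestronglyMeasurable
  · filter_upwards [hmem] with r hr
    refine Eventually.of_forall fun x => ?_
    have hpos : 0 < r - s := sub_pos.2 hr.1
    rw [slope_def_field, norm_div, Real.norm_eq_abs, Real.norm_eq_abs, abs_of_pos hpos,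
      div_le_iff₀ hpos]
    exact abs_transported_sub_le hv hε hφ hK hφK hC hgen hs hr.1.le hr.2 x
  · rw [← hasDerivWithinAt_iff_tendsto_slope' self_notMem_Ioi, hasDerivWithinAt_Ioi_iff_Ici]
    exact hasDerivWithinAt_transported hv ε hφ hs x

end Evolution

/-! ### Momentum tightness -/

/-- The momentum as a continuous linear map. -/
noncomputable def momentumL (d : ℕ) : Phase d →L[ℝ] Pos d :=
  LinearMap.toContinuousLinearMap
    { toFun := momentum, map_add' := fun _ _ => rfl, map_smul' := fun _ _ => rfl }

/-- The position as a continuous linear map. -/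
noncomputable def positionL (d : ℕ) : Phase d →L[ℝ] Pos d :=
  LinearMap.toContinuousLinearMap
    { toFun := position, map_add' := fun _ _ => rfl, map_smul' := fun _ _ => rfl }

lemma momentumL_apply {d : ℕ} (x : Phase d) : momentumL d x = momentum x := rfl

lemma positionL_apply {d : ℕ} (x : Phase d) : positionL d x = position x := rfl

@[fun_prop]
lemma continuous_momentum {d : ℕ} : Continuous (momentum : Phase d → Pos d) :=
  (momentumL d).continuous

@[fun_prop]
lemma continuous_position {d : ℕ} : Continuous (position : Phase d → Pos d) :=
  (positionL d).continuous

lemma norm_sq_eq_momentum_position {d : ℕ} (x : Phase d) :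
    ‖x‖ ^ 2 = ‖momentum x‖ ^ 2 + ‖position x‖ ^ 2 := by
  rw [EuclideanSpace.norm_sq_eq, EuclideanSpace.norm_sq_eq, EuclideanSpace.norm_sq_eq,
    Fintype.sum_sum_type]
  rfl

lemma norm_le_momentum_add_position {d : ℕ} (x : Phase d) :
    ‖x‖ ≤ ‖momentum x‖ + ‖position x‖ := by
  have := norm_sq_eq_momentum_position x
  have h1 := norm_nonneg (momentum x)
  have h2 := norm_nonneg (position x)
  refine (sq_le_sq₀ (norm_nonneg _) (by positivity)).1 ?_
  nlinarith [mul_nonneg h1 h2]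

lemma norm_momentum_le {d : ℕ} (x : Phase d) : ‖momentum x‖ ≤ ‖x‖ := by
  refine (sq_le_sq₀ (norm_nonneg _) (norm_nonneg _)).1 ?_
  rw [norm_sq_eq_momentum_position x]
  nlinarith [sq_nonneg ‖position x‖]

lemma norm_position_le {d : ℕ} (x : Phase d) : ‖position x‖ ≤ ‖x‖ := by
  refine (sq_le_sq₀ (norm_nonneg _) (norm_nonneg _)).1 ?_
  rw [norm_sq_eq_momentum_position x]
  nlinarith [sq_nonneg ‖momentum x‖]

/-- A set of measures is momentum tight if, over each bounded set of positions, large momenta carry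
uniformly little mass.  Mass may still escape to infinity in position. -/
noncomputable def MomentumTight {d : ℕ} (S : Set (Measure (Phase d))) : Prop :=
  ∀ R δ : ℝ, 0 < δ → ∃ P : ℝ, ∀ μ ∈ S,
    μ {x | ‖position x‖ < R ∧ P < ‖momentum x‖} ≤ ENNReal.ofReal δ

lemma isOpen_tail {d : ℕ} (R P : ℝ) :
    IsOpen {x : Phase d | ‖position x‖ < R ∧ P < ‖momentum x‖} :=
  (isOpen_lt continuous_position.norm continuous_const).inter
    (isOpen_lt continuous_const continuous_momentum.norm)

lemma abs_integral_sub_le_tail {d : ℕ} {μ : Measure (Phase d)} [IsFiniteMeasure μ]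
    {f g : Phase d → ℝ} {M δ : ℝ} (hM : 0 ≤ M) (hδ : 0 ≤ δ) (hf : Integrable f μ)
    (hg : Integrable g μ) {U : Set (Phase d)} (hU : MeasurableSet U)
    (hUμ : μ U ≤ ENNReal.ofReal δ) (hfg : ∀ x, |f x - g x| ≤ U.indicator (fun _ => M) x) :
    |∫ x, f x ∂μ - ∫ x, g x ∂μ| ≤ M * δ := by
  rw [← integral_sub hf hg, ← Real.norm_eq_abs]
  calc ‖∫ x, (f x - g x) ∂μ‖ ≤ ∫ x, U.indicator (fun _ => M) x ∂μ :=
        norm_integral_le_of_norm_le ((integrable_const M).indicator hU) (Eventually.of_forall hfg)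
    _ = μ.real U * M := by rw [integral_indicator hU, setIntegral_const, smul_eq_mul]
    _ ≤ δ * M := by
        gcongr
        exact ENNReal.toReal_le_of_le_ofReal hδ hUμ
    _ = M * δ := mul_comm _ _

/-- Under momentum tightness, test functions need compact support in the position only. -/
lemma DistTendsto.tendsto_integral_of_momentumTight {d : ℕ} {ι : Type*}
    {μ : ι → Measure (Phase d)} {l : Filter ι} [l.NeBot] {ν : Measure (Phase d)}
    (h : DistTendsto μ l ν) [IsFiniteMeasure ν] (hμ : ∀ᶠ i in l, μ i univ ≤ 1)
    {S : Set (Measure (Phase d))} (hS : MomentumTight S) (hmem : ∀ᶠ i in l, μ i ∈ S)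
    {f : Phase d → ℝ} (hf : Continuous f) {M : ℝ} (hM : ∀ x, |f x| ≤ M) {R : ℝ}
    (hR : ∀ x, R ≤ ‖position x‖ → f x = 0) :
    Tendsto (fun i => ∫ x, f x ∂(μ i)) l (𝓝 (∫ x, f x ∂ν)) := by
  have hM0 : 0 ≤ M := (abs_nonneg _).trans (hM 0)
  rw [Metric.tendsto_nhds]
  intro δ hδ
  set η : ℝ := δ / (4 * (M + 1)) with hη
  have hη0 : 0 < η := by positivity
  have hMη : M * η ≤ δ / 4 := by
    calc M * η ≤ (M + 1) * η := by gcongr; linarith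
      _ = δ / 4 := by rw [hη]; field_simp
  obtain ⟨P, hP⟩ := hS R η hη0
  set U := {x : Phase d | ‖position x‖ < R ∧ P < ‖momentum x‖}
  have hU : IsOpen U := isOpen_tail R P
  -- `χ` cuts off the momenta beyond `P`.
  let χ : Phase d → ℝ := fun x => max 0 (min 1 (P + 1 - ‖momentum x‖))
  have hχc : Continuous χ := by fun_prop
  have hχ0 : ∀ x, 0 ≤ χ x := fun x => le_max_left _ _
  have hχ1 : ∀ x, χ x ≤ 1 := fun x => max_le zero_le_one (min_le_left _ _)
  let g : Phase d → ℝ := fun x => f x * χ x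
  have hgc : Continuous g := hf.mul hχc
  have hgs : HasCompactSupport g := by
    refine HasCompactSupport.intro (isCompact_closedBall (0 : Phase d) (|P| + 1 + |R|))
      fun x hx => ?_
    have hx' : |P| + 1 + |R| < ‖x‖ := by simpa using hx
    have hle := norm_le_momentum_add_position x
    rcases le_or_gt R ‖position x‖ with h1 | h1
    · simp [g, hR x h1]
    · have : P + 1 - ‖momentum x‖ ≤ 0 := by linarith [le_abs_self P, le_abs_self R]
      have : χ x = 0 := max_eq_left ((min_le_right _ _).trans this)
      simp [g, this]
  have hfg : ∀ x, |f x - g x| ≤ U.indicator (fun _ => M) x := by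
    intro x
    by_cases hx : x ∈ U
    · rw [indicator_of_mem hx]
      have : f x - g x = f x * (1 - χ x) := by simp only [g]; ring
      rw [this, abs_mul, abs_of_nonneg (by linarith [hχ1 x] : 0 ≤ 1 - χ x)]
      calc _ ≤ M * 1 := mul_le_mul (hM x) (by linarith [hχ0 x]) (by linarith [hχ1 x]) hM0
        _ = M := mul_one M
    · rw [indicator_of_notMem hx]
      rcases le_or_gt R ‖position x‖ with h1 | h1
      · simp [g, hR x h1]
      · have h2 : ‖momentum x‖ ≤ P := not_lt.1 fun h2 => hx ⟨h1, h2⟩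
        have : χ x = 1 := by
          simp only [χ]
          rw [min_eq_left (by linarith), max_eq_right zero_le_one]
        simp [g, this]
  have hint : ∀ ρ : Measure (Phase d), IsFiniteMeasure ρ → Integrable f ρ := fun ρ _ =>
    Integrable.of_bound hf.aestronglyMeasurable M (Eventually.of_forall hM)
  have hνU : ν U ≤ ENNReal.ofReal η :=
    h.measure_le_of_isOpen hμ hU (hmem.mono fun i hi => hP _ hi)
  have e2 := abs_integral_sub_le_tail (μ := ν) hM0 hη0.le (hint ν inferInstance)
    (hgc.integrable_of_hasCompactSupport hgs) hU.measurableSet hνU hfg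
  filter_upwards [hμ, hmem, Metric.tendsto_nhds.1 (h.tendsto_integral hμ hgc hgs) (δ / 4)
    (by positivity)] with i hi himem hi2
  have := isFiniteMeasure_of_le_one hi
  have e1 := abs_integral_sub_le_tail (μ := μ i) hM0 hη0.le (hint _ inferInstance)
    (hgc.integrable_of_hasCompactSupport hgs) hU.measurableSet (hP _ himem) hfg
  rw [Real.dist_eq, abs_lt] at hi2 ⊢
  rw [abs_le] at e1 e2
  constructor <;> linarith [hi2.1, hi2.2, e1.1, e1.2, e2.1, e2.2]

/-! ### The Hamiltonian field -/

lemma norm_gradient {d : ℕ} (f : Pos d → ℝ) (q : Pos d) : ‖gradient f q‖ = ‖fderiv ℝ f q‖ :=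
  LinearIsometryEquiv.norm_map _ _

lemma dist_gradient {d : ℕ} (f : Pos d → ℝ) (q q' : Pos d) :
    dist (gradient f q) (gradient f q') = dist (fderiv ℝ f q) (fderiv ℝ f q') :=
  LinearIsometryEquiv.dist_map _ _ _

lemma inner_gradient {d : ℕ} (f : Pos d → ℝ) (q w : Pos d) :
    inner ℝ (gradient f q) w = fderiv ℝ f q w := by
  simp [gradient]

lemma continuous_gradient {d : ℕ} {f : Pos d → ℝ} (hf : ContDiff ℝ 1 f) :
    Continuous (gradient f) :=
  (LinearIsometryEquiv.continuous _).comp (hf.continuous_fderiv (by norm_num))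

lemma locallyLipschitz_gradient {d : ℕ} {f : Pos d → ℝ} (hf : ContDiff ℝ 2 f) :
    LocallyLipschitz (gradient f) := by
  have h1 : ContDiff ℝ 1 (fderiv ℝ f) := hf.fderiv_right (by norm_num)
  exact (LinearIsometryEquiv.lipschitz _).locallyLipschitz.comp h1.locallyLipschitz

/-- The mean force field `(∇W * μ)(q) = ∫ ∇W (q - q') dμ(p', q')`. -/
noncomputable def meanForce {d : ℕ} (W : Pos d → ℝ) (μ : Measure (Phase d)) (q : Pos d) : Pos d :=
  ∫ x, gradient W (q - position x) ∂μ

namespace AdmissiblePotentials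

variable {d : ℕ} {W Φ : Pos d → ℝ} {μ : Measure (Phase d)}

lemma continuous_gradient_W (h : AdmissiblePotentials W Φ) : Continuous (gradient W) :=
  continuous_gradient (h.W_contDiff.of_le (by norm_num))

lemma continuous_gradient_Φ (h : AdmissiblePotentials W Φ) : Continuous (gradient Φ) :=
  continuous_gradient (h.Φ_contDiff.of_le (by norm_num))

lemma hasCompactSupport_gradient_W (h : AdmissiblePotentials W Φ) :
    HasCompactSupport (gradient W) := by
  refine (h.W_compact.fderiv (𝕜 := ℝ)).mono fun q hq => ?_
  rw [Function.mem_support, ← norm_ne_zero_iff] at hq ⊢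
  rwa [← norm_gradient]

lemma exists_bound_gradient_W (h : AdmissiblePotentials W Φ) :
    ∃ q₀, ∀ q, ‖gradient W q‖ ≤ ‖gradient W q₀‖ :=
  h.continuous_gradient_W.norm.exists_forall_ge_of_hasCompactSupport
    h.hasCompactSupport_gradient_W.norm

lemma exists_lipschitz_gradient_W (h : AdmissiblePotentials W Φ) :
    ∃ K : NNReal, LipschitzWith K (gradient W) := by
  have h1 : ContDiff ℝ 1 (fderiv ℝ W) := h.W_contDiff.fderiv_right (by norm_num)
  obtain ⟨K, hK⟩ := h1.lipschitzWith_of_hasCompactSupport (h.W_compact.fderiv (𝕜 := ℝ))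
    one_ne_zero
  exact ⟨K, LipschitzWith.of_dist_le_mul fun q q' => by
    rw [dist_gradient]; exact hK.dist_le_mul q q'⟩

lemma integrable_gradient_W (h : AdmissiblePotentials W Φ) [IsFiniteMeasure μ] (q : Pos d) :
    Integrable (fun x => gradient W (q - position x)) μ := by
  obtain ⟨q₀, hq₀⟩ := h.exists_bound_gradient_W
  have : Continuous fun x : Phase d => gradient W (q - position x) :=
    h.continuous_gradient_W.comp (by fun_prop)
  exact Integrable.of_bound this.aestronglyMeasurable _ (Eventually.of_forall fun x => hq₀ _)

/-- Differentiation under the integral: `∇(W * μ + Φ) = ∇W * μ + ∇Φ`. -/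
lemma gradient_interaction_add (h : AdmissiblePotentials W Φ) [IsFiniteMeasure μ] (q : Pos d) :
    gradient (fun q => interaction W μ q + Φ q) q = meanForce W μ q + gradient Φ q := by
  obtain ⟨q₀, hq₀⟩ := h.exists_bound_gradient_W
  have hW1 : Continuous (fderiv ℝ W) := h.W_contDiff.continuous_fderiv (by norm_num)
  obtain ⟨M, hM⟩ := h.W_contDiff.continuous.bounded_above_of_compact_support h.W_compact
  have hsub : ∀ q' : Pos d, Continuous fun x : Phase d => q' - position x := fun q' => by fun_prop
  have hFint : Integrable (fun x => fderiv ℝ W (q - position x)) μ :=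
    Integrable.of_bound (hW1.comp (hsub q)).aestronglyMeasurable ‖gradient W q₀‖
      (Eventually.of_forall fun x => by rw [← norm_gradient]; exact hq₀ _)
  have hder : HasFDerivAt (interaction W μ) (∫ x, fderiv ℝ W (q - position x) ∂μ) q := by
    refine hasFDerivAt_integral_of_dominated_of_fderiv_le
      (F := fun q x => W (q - position x)) (F' := fun q x => fderiv ℝ W (q - position x))
      (bound := fun _ => ‖gradient W q₀‖) univ_mem
      (Eventually.of_forall fun q' =>
        (h.W_contDiff.continuous.comp (hsub q')).aestronglyMeasurable) ?_
      (hW1.comp (hsub q)).aestronglyMeasurable ?_ (integrable_const _) ?_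
    · exact Integrable.of_bound (h.W_contDiff.continuous.comp (hsub q)).aestronglyMeasurable M
        (Eventually.of_forall fun x => hM _)
    · exact Eventually.of_forall fun x q' _ => by rw [← norm_gradient]; exact hq₀ _
    · refine Eventually.of_forall fun x q' _ => ?_
      have h1 := (h.W_contDiff.differentiable (by norm_num) (q' - position x)).hasFDerivAt
      have := h1.comp q' ((hasFDerivAt_id q').sub_const (position x))
      exact this
  have hΦ := (h.Φ_contDiff.differentiable (by norm_num) q).hasFDerivAt
  have hsum := hder.fun_add hΦ
  refine ext_inner_right ℝ fun w => ?_
  rw [inner_gradient, hsum.fderiv, inner_add_left, inner_gradient, add_apply,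
    ContinuousLinearMap.integral_apply hFint, meanForce, real_inner_comm,
    ← integral_inner (h.integrable_gradient_W q)]
  congr 1
  refine integral_congr_ae (Eventually.of_forall fun x => ?_)
  simp only
  rw [real_inner_comm, inner_gradient]

lemma norm_meanForce_le {M : ℝ} (hM : ∀ q, ‖gradient W q‖ ≤ M) (hμ : μ univ ≤ 1) (q : Pos d) :
    ‖meanForce W μ q‖ ≤ M :=
  norm_integral_le_of_mass_le_one hμ ((norm_nonneg _).trans (hM 0)) fun _ => hM _

lemma lipschitzWith_meanForce (h : AdmissiblePotentials W Φ) {K : NNReal}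
    (hK : LipschitzWith K (gradient W)) (hμ : μ univ ≤ 1) : LipschitzWith K (meanForce W μ) := by
  have := isFiniteMeasure_of_le_one hμ
  refine LipschitzWith.of_dist_le_mul fun q q' => ?_
  rw [dist_eq_norm, meanForce, meanForce,
    ← integral_sub (h.integrable_gradient_W q) (h.integrable_gradient_W q')]
  refine norm_integral_le_of_mass_le_one hμ (by positivity) fun x => ?_
  rw [← dist_eq_norm]
  refine (hK.dist_le_mul _ _).trans_eq ?_
  rw [dist_sub_right]

lemma hamField_eq (h : AdmissiblePotentials W Φ) [IsFiniteMeasure μ] (x : Phase d) :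
    hamField W Φ μ x =
      phasePoint (-(meanForce W μ (position x) + gradient Φ (position x))) (momentum x) := by
  rw [← h.gradient_interaction_add]
  rfl

end AdmissiblePotentials

lemma momentum_phasePoint {d : ℕ} (p q : Pos d) : momentum (phasePoint p q) = p := rfl

lemma position_phasePoint {d : ℕ} (p q : Pos d) : position (phasePoint p q) = q := rfl

lemma lipschitzWith_phasePoint {d : ℕ} :
    LipschitzWith 2 fun z : Pos d × Pos d => phasePoint z.1 z.2 := by
  refine LipschitzWith.of_dist_le_mul fun z z' => ?_
  rw [dist_eq_norm, dist_eq_norm]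
  refine (norm_le_momentum_add_position _).trans ?_
  have h1 : momentum (phasePoint z.1 z.2 - phasePoint z'.1 z'.2) = (z - z').1 := rfl
  have h2 : position (phasePoint z.1 z.2 - phasePoint z'.1 z'.2) = (z - z').2 := rfl
  rw [h1, h2]
  have := norm_fst_le (z - z')
  have := norm_snd_le (z - z')
  push_cast
  linarith

namespace AdmissiblePotentials

variable {d : ℕ} {W Φ : Pos d → ℝ} {μ : Measure (Phase d)}

lemma locallyLipschitz_hamField (h : AdmissiblePotentials W Φ) (hμ : μ univ ≤ 1) :
    LocallyLipschitz (hamField W Φ μ) := by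
  have := isFiniteMeasure_of_le_one hμ
  obtain ⟨K, hK⟩ := h.exists_lipschitz_gradient_W
  have h1 : LocallyLipschitz fun x : Phase d => meanForce W μ (position x) :=
    ((h.lipschitzWith_meanForce hK hμ).comp (positionL d).lipschitz).locallyLipschitz
  have h2 : LocallyLipschitz fun x : Phase d => gradient Φ (position x) :=
    (locallyLipschitz_gradient h.Φ_contDiff).comp (positionL d).lipschitz.locallyLipschitz
  have h3 : LocallyLipschitz fun x : Phase d =>
      -(meanForce W μ (position x) + gradient Φ (position x)) := (h1.add h2).neg
  have h4 : LocallyLipschitz fun x : Phase d => momentum x :=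
    (momentumL d).lipschitz.locallyLipschitz
  have h5 := lipschitzWith_phasePoint.locallyLipschitz.comp (h3.prodMk h4)
  have : hamField W Φ μ = fun x => phasePoint
      (-(meanForce W μ (position x) + gradient Φ (position x))) (momentum x) :=
    funext h.hamField_eq
  rw [this]
  exact h5

lemma norm_hamField_le (h : AdmissiblePotentials W Φ) {M : ℝ} (hM : ∀ q, ‖gradient W q‖ ≤ M)
    (hμ : μ univ ≤ 1) (x : Phase d) :
    ‖hamField W Φ μ x‖ ≤ M + ‖gradient Φ (position x)‖ + ‖momentum x‖ := by
  have := isFiniteMeasure_of_le_one hμ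
  rw [h.hamField_eq]
  refine (norm_le_momentum_add_position _).trans ?_
  rw [momentum_phasePoint, position_phasePoint, norm_neg]
  have h1 := norm_add_le (meanForce W μ (position x)) (gradient Φ (position x))
  have h2 := norm_meanForce_le hM hμ (position x)
  linarith

lemma norm_hamField_sub_le (h : AdmissiblePotentials W Φ) {μ' : Measure (Phase d)}
    [IsFiniteMeasure μ] [IsFiniteMeasure μ'] (x : Phase d) :
    ‖hamField W Φ μ x - hamField W Φ μ' x‖ ≤
      dist (meanForce W μ (position x)) (meanForce W μ' (position x)) := by
  rw [h.hamField_eq, h.hamField_eq]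
  refine (norm_le_momentum_add_position _).trans ?_
  have h1 : ∀ a b c : Pos d, momentum (phasePoint a c - phasePoint b c) = a - b :=
    fun _ _ _ => rfl
  have h2 : ∀ a b c : Pos d, position (phasePoint a c - phasePoint b c) = c - c :=
    fun _ _ _ => rfl
  rw [h1, h2, sub_self, norm_zero, add_zero, dist_comm, dist_eq_norm]
  refine (congrArg _ ?_).le
  abel

/-- The generators of all sub-probability measures are bounded together on a fixed test
function. -/
lemma exists_bound_generator (h : AdmissiblePotentials W Φ) {φ : ℝ × Phase d → ℝ}
    (hφ : ContDiff ℝ 1 φ) {K : Set (Phase d)} (hK : IsCompact K)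
    (hφK : ∀ t x, x ∉ K → φ (t, x) = 0) (T ε₀ : ℝ) : ∃ C : ℝ, 0 ≤ C ∧
      ∀ ε, 0 ≤ ε → ε ≤ ε₀ → ∀ μ : Measure (Phase d), μ univ ≤ 1 → ∀ t ∈ Icc 0 T, ∀ x,
        |deficientGenerator ε (hamField W Φ μ) φ (t, x)| ≤ C := by
  obtain ⟨q₀, hq₀⟩ := h.exists_bound_gradient_W
  have hcomp : IsCompact (Icc 0 T ×ˢ K) := isCompact_Icc.prod hK
  obtain ⟨C₁, hC₁⟩ := hcomp.exists_bound_of_continuousOn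
    (hφ.continuous_fderiv (by norm_num)).continuousOn
  obtain ⟨C₂, hC₂⟩ := hcomp.exists_bound_of_continuousOn hφ.continuous.continuousOn
  have hcv : Continuous fun x : Phase d =>
      ‖gradient W q₀‖ + ‖gradient Φ (position x)‖ + ‖momentum x‖ :=
    (continuous_const.add (h.continuous_gradient_Φ.comp continuous_position).norm).add
      continuous_momentum.norm
  obtain ⟨C₃, hC₃⟩ := hK.exists_bound_of_continuousOn hcv.continuousOn
  refine ⟨|C₁| + |C₁| * |C₃| + |ε₀| * |C₃| * |C₂|, by positivity,
    fun ε hε hεε₀ μ hμ t ht x => ?_⟩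
  by_cases hx : x ∈ K
  · have hv : ‖hamField W Φ μ x‖ ≤ |C₃| :=
      (h.norm_hamField_le hq₀ hμ x).trans ((le_abs_self _).trans ((hC₃ x hx).trans (le_abs_self _)))
    have hD : ‖fderiv ℝ φ (t, x)‖ ≤ |C₁| := (hC₁ _ ⟨ht, hx⟩).trans (le_abs_self _)
    have hF : |φ (t, x)| ≤ |C₂| := (hC₂ _ ⟨ht, hx⟩).trans (le_abs_self _)
    have e1 : |fderiv ℝ φ (t, x) (1, 0)| ≤ |C₁| := by
      rw [← Real.norm_eq_abs]
      refine (ContinuousLinearMap.le_opNorm _ _).trans ?_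
      have : ‖((1 : ℝ), (0 : Phase d))‖ = 1 := by simp [Prod.norm_def]
      rw [this, mul_one]
      exact hD
    have e2 : |fderiv ℝ φ (t, x) (0, hamField W Φ μ x)| ≤ |C₁| * |C₃| := by
      rw [← Real.norm_eq_abs]
      refine (ContinuousLinearMap.le_opNorm _ _).trans ?_
      have : ‖((0 : ℝ), hamField W Φ μ x)‖ = ‖hamField W Φ μ x‖ := by simp [Prod.norm_def]
      rw [this]
      gcongr
    have e3 : |ε * ‖hamField W Φ μ x‖ * φ (t, x)| ≤ |ε₀| * |C₃| * |C₂| := by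
      rw [abs_mul, abs_mul, abs_of_nonneg hε, abs_norm]
      have := hεε₀.trans (le_abs_self _)
      gcongr
    unfold deficientGenerator
    exact (abs_sub _ _).trans (add_le_add ((abs_add_le _ _).trans (add_le_add e1 e2)) e3)
  · rw [deficientGenerator_eq_zero ε _ hK.isClosed hφK t hx, abs_zero]
    positivity

/-- Distributional convergence and momentum tightness give convergence of the mean force. -/
lemma tendsto_meanForce (h : AdmissiblePotentials W Φ) {ι : Type*} {μ : ι → Measure (Phase d)}
    {l : Filter ι} [l.NeBot] {ν : Measure (Phase d)} (hconv : DistTendsto μ l ν)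
    [IsFiniteMeasure ν] (hμ : ∀ᶠ i in l, μ i univ ≤ 1)
    {S : Set (Measure (Phase d))} (hS : MomentumTight S) (hmem : ∀ᶠ i in l, μ i ∈ S) (q : Pos d) :
    Tendsto (fun i => meanForce W (μ i) q) l (𝓝 (meanForce W ν q)) := by
  obtain ⟨q₀, hq₀⟩ := h.exists_bound_gradient_W
  obtain ⟨R, hR⟩ := h.hasCompactSupport_gradient_W.isCompact.isBounded.exists_norm_le
  have hcoord : ∀ (ρ : Measure (Phase d)) (_ : IsFiniteMeasure ρ) (j : Fin d),
      meanForce W ρ q j = ∫ x, gradient W (q - position x) j ∂ρ := fun ρ _ j =>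
    ((EuclideanSpace.proj (𝕜 := ℝ) j).integral_comp_comm (h.integrable_gradient_W q)).symm
  have key : ∀ j : Fin d, Tendsto (fun i => meanForce W (μ i) q j) l (𝓝 (meanForce W ν q j)) := by
    intro j
    rw [hcoord ν inferInstance j]
    have hc : Continuous fun x : Phase d => gradient W (q - position x) j :=
      (EuclideanSpace.proj (𝕜 := ℝ) j).continuous.comp
        (h.continuous_gradient_W.comp (by fun_prop))
    refine Tendsto.congr' ?_ (hconv.tendsto_integral_of_momentumTight hμ hS hmem hc
      (M := ‖gradient W q₀‖) (fun x => (PiLp.norm_apply_le _ j).trans (hq₀ _))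
      (R := ‖q‖ + R + 1) fun x hx => ?_)
    · filter_upwards [hμ] with i hi
      exact (hcoord _ (isFiniteMeasure_of_le_one hi) j).symm
    · have : gradient W (q - position x) = 0 := by
        refine image_eq_zero_of_notMem_tsupport fun hmem' => ?_
        have h1 := hR _ hmem'
        have h2 := norm_sub_norm_le (position x) q
        rw [norm_sub_rev] at h2
        linarith
      rw [this]
      rfl
  have := ((EuclideanSpace.equiv (Fin d) ℝ).symm.continuous.tendsto _).comp
    (tendsto_pi_nhds.2 key)
  exact this

end AdmissiblePotentials

/-- Pointwise convergence of equi-Lipschitz functions is uniform on compact sets. -/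
lemma eventually_forall_dist_le_of_lipschitz {ι X Y : Type*} [PseudoMetricSpace X]
    [PseudoMetricSpace Y] {l : Filter ι} {F : ι → X → Y} {f : X → Y} {K : NNReal}
    (hF : ∀ᶠ i in l, LipschitzWith K (F i)) (hf : LipschitzWith K f)
    (hlim : ∀ x, Tendsto (fun i => F i x) l (𝓝 (f x))) {Q : Set X} (hQ : IsCompact Q) {δ : ℝ}
    (hδ : 0 < δ) : ∀ᶠ i in l, ∀ x ∈ Q, dist (F i x) (f x) ≤ δ := by
  set η : ℝ := δ / (3 * (K + 1)) with hη
  have hη0 : 0 < η := by positivity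
  have hKη : K * η ≤ δ / 3 := by
    calc (K : ℝ) * η ≤ (K + 1) * η := by gcongr; linarith
      _ = δ / 3 := by rw [hη]; field_simp
  obtain ⟨t, -, htf, htc⟩ := hQ.finite_cover_balls hη0
  have hev : ∀ᶠ i in l, ∀ y ∈ t, dist (F i y) (f y) < δ / 3 :=
    (htf.eventually_all).2 fun y _ => Metric.tendsto_nhds.1 (hlim y) _ (by positivity)
  filter_upwards [hF, hev] with i hi hi2 x hx
  obtain ⟨y, hy, hxy⟩ := mem_iUnion₂.1 (htc hx)
  have h1 : dist (F i x) (F i y) ≤ δ / 3 :=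
    (hi.dist_le_mul x y).trans (le_trans (by gcongr; exact (Metric.mem_ball.1 hxy).le) hKη)
  have h2 : dist (f y) (f x) ≤ δ / 3 := by
    rw [dist_comm]
    exact (hf.dist_le_mul x y).trans (le_trans (by gcongr; exact (Metric.mem_ball.1 hxy).le) hKη)
  have h3 := hi2 y hy
  have h4 := dist_triangle4 (F i x) (F i y) (f y) (f x)
  linarith

/-- Stability of the generator term: the field is generated by `f i`, the test measure is `m i`,
and the deficiency is `ε i`; all three converge. -/
theorem AdmissiblePotentials.tendsto_integral_generator {d : ℕ} {W Φ : Pos d → ℝ}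
    (h : AdmissiblePotentials W Φ) {ι : Type*} {l : Filter ι} [l.NeBot]
    {m f : ι → Measure (Phase d)} {m' f' : Measure (Phase d)} {ε : ι → ℝ} {ε' : ℝ}
    (hm : DistTendsto m l m') (hf : DistTendsto f l f') (hε : Tendsto ε l (𝓝 ε'))
    (hm1 : ∀ᶠ i in l, m i univ ≤ 1) (hf1 : ∀ᶠ i in l, f i univ ≤ 1)
    (hm'1 : m' univ ≤ 1) (hf'1 : f' univ ≤ 1)
    {S : Set (Measure (Phase d))} (hS : MomentumTight S) (hmem : ∀ᶠ i in l, f i ∈ S)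
    {φ : ℝ × Phase d → ℝ} (hφ : ContDiff ℝ 1 φ) {K : Set (Phase d)} (hK : IsCompact K)
    (hφK : ∀ t x, x ∉ K → φ (t, x) = 0) (t : ℝ) :
    Tendsto (fun i => ∫ x, deficientGenerator (ε i) (hamField W Φ (f i)) φ (t, x) ∂(m i)) l
      (𝓝 (∫ x, deficientGenerator ε' (hamField W Φ f') φ (t, x) ∂m')) := by
  have hfin := isFiniteMeasure_of_le_one hm'1
  have hfin' := isFiniteMeasure_of_le_one hf'1
  obtain ⟨L, hL⟩ := h.exists_lipschitz_gradient_W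
  have hv' := (h.locallyLipschitz_hamField hf'1).continuous
  obtain ⟨C₁, hC₁⟩ := hK.exists_bound_of_continuousOn
    (f := fun x => fderiv ℝ φ (t, x))
    ((hφ.continuous_fderiv (by norm_num)).comp (by fun_prop)).continuousOn
  obtain ⟨C₂, hC₂⟩ := hK.exists_bound_of_continuousOn (f := fun x => φ (t, x))
    (hφ.continuous.comp (by fun_prop)).continuousOn
  obtain ⟨C₃, hC₃⟩ := hK.exists_bound_of_continuousOn hv'.continuousOn
  have hcont : ∀ (e : ℝ) (ρ : Measure (Phase d)), ρ univ ≤ 1 →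
      Continuous fun x => deficientGenerator e (hamField W Φ ρ) φ (t, x) := fun e ρ hρ =>
    (continuous_deficientGenerator e (h.locallyLipschitz_hamField hρ).continuous hφ).comp
      (by fun_prop)
  have hcs : ∀ (e : ℝ) (ρ : Measure (Phase d)),
      HasCompactSupport fun x => deficientGenerator e (hamField W Φ ρ) φ (t, x) := fun e ρ =>
    HasCompactSupport.intro hK fun x hx => deficientGenerator_eq_zero e _ hK.isClosed hφK t hx
  have hmain := hm.tendsto_integral hm1 (hcont ε' f' hf'1) (hcs ε' f')
  rw [Metric.tendsto_nhds] at hmain ⊢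
  intro δ hδ
  -- The difference of the two generators is at most `A η` once fields and deficiencies are
  -- `η`-close.
  set A : ℝ := |C₁| + (|ε'| + 1) * |C₂| + |C₃| * |C₂| + 1
  have hA : 0 < A := by positivity
  set η : ℝ := min 1 (δ / (2 * A)) with hη
  have hη0 : 0 < η := lt_min one_pos (by positivity)
  have hAη : A * η ≤ δ / 2 := by
    calc A * η ≤ A * (δ / (2 * A)) := by gcongr; exact min_le_right _ _
      _ = δ / 2 := by field_simp
  have hunif := eventually_forall_dist_le_of_lipschitz
    (hf1.mono fun i hi => h.lipschitzWith_meanForce hL hi) (h.lipschitzWith_meanForce hL hf'1)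
    (h.tendsto_meanForce hf hf1 hS hmem) (hK.image continuous_position) hη0
  filter_upwards [hm1, hf1, hunif, hmain (δ / 2) (by positivity),
    Metric.tendsto_nhds.1 hε η hη0] with i hmi hfi hui hi hεi
  have hfin1 := isFiniteMeasure_of_le_one hmi
  have hfin2 := isFiniteMeasure_of_le_one hfi
  rw [Real.dist_eq] at hεi
  have hdiff : ∀ x, |deficientGenerator (ε i) (hamField W Φ (f i)) φ (t, x) -
      deficientGenerator ε' (hamField W Φ f') φ (t, x)| ≤ A * η := by
    intro x
    by_cases hx : x ∈ K
    · have hd : ‖hamField W Φ (f i) x - hamField W Φ f' x‖ ≤ η :=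
        (h.norm_hamField_sub_le x).trans (hui _ (mem_image_of_mem _ hx))
      have e1 : |fderiv ℝ φ (t, x) (0, hamField W Φ (f i) x - hamField W Φ f' x)| ≤ |C₁| * η := by
        rw [← Real.norm_eq_abs]
        refine (ContinuousLinearMap.le_opNorm _ _).trans ?_
        have : ‖((0 : ℝ), hamField W Φ (f i) x - hamField W Φ f' x)‖ =
          ‖hamField W Φ (f i) x - hamField W Φ f' x‖ := by simp [Prod.norm_def]
        rw [this]
        gcongr
        exact (hC₁ x hx).trans (le_abs_self _)
      have hφx : |φ (t, x)| ≤ |C₂| := (hC₂ x hx).trans (le_abs_self _)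
      have hvx : |‖hamField W Φ f' x‖| ≤ |C₃| := by
        rw [abs_norm]; exact (hC₃ x hx).trans (le_abs_self _)
      have hεa : |ε i| ≤ |ε'| + 1 := by
        have := abs_sub_abs_le_abs_sub (ε i) ε'
        have := min_le_left 1 (δ / (2 * A))
        linarith
      have e2 : |ε i * (‖hamField W Φ (f i) x‖ - ‖hamField W Φ f' x‖) * φ (t, x)| ≤
          (|ε'| + 1) * η * |C₂| := by
        rw [abs_mul, abs_mul]
        gcongr
        exact (abs_norm_sub_norm_le _ _).trans hd
      have e3 : |(ε i - ε') * ‖hamField W Φ f' x‖ * φ (t, x)| ≤ η * |C₃| * |C₂| := by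
        rw [abs_mul, abs_mul]
        gcongr
      have hlin : fderiv ℝ φ (t, x) (0, hamField W Φ (f i) x - hamField W Φ f' x) =
          fderiv ℝ φ (t, x) (0, hamField W Φ (f i) x) -
            fderiv ℝ φ (t, x) (0, hamField W Φ f' x) := by
        rw [← map_sub]
        simp
      have hsplit : deficientGenerator (ε i) (hamField W Φ (f i)) φ (t, x) -
          deficientGenerator ε' (hamField W Φ f') φ (t, x) =
          fderiv ℝ φ (t, x) (0, hamField W Φ (f i) x - hamField W Φ f' x) -
          (ε i * (‖hamField W Φ (f i) x‖ - ‖hamField W Φ f' x‖) * φ (t, x) +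
          (ε i - ε') * ‖hamField W Φ f' x‖ * φ (t, x)) := by
        rw [hlin]
        simp only [deficientGenerator]
        ring
      rw [hsplit]
      have h1 := abs_sub (fderiv ℝ φ (t, x) (0, hamField W Φ (f i) x - hamField W Φ f' x))
        (ε i * (‖hamField W Φ (f i) x‖ - ‖hamField W Φ f' x‖) * φ (t, x) +
          (ε i - ε') * ‖hamField W Φ f' x‖ * φ (t, x))
      have h2 := abs_add_le (ε i * (‖hamField W Φ (f i) x‖ - ‖hamField W Φ f' x‖) * φ (t, x))
        ((ε i - ε') * ‖hamField W Φ f' x‖ * φ (t, x))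
      have h3 : A * η = |C₁| * η + (|ε'| + 1) * η * |C₂| + η * |C₃| * |C₂| + η := by
        simp only [A]; ring
      linarith
    · rw [deficientGenerator_eq_zero _ _ hK.isClosed hφK t hx,
        deficientGenerator_eq_zero _ _ hK.isClosed hφK t hx, sub_zero, abs_zero]
      positivity
  have e1 := abs_integral_sub_le_of_mass_le_one hmi (by positivity)
    ((hcont (ε i) (f i) hfi).integrable_of_hasCompactSupport (hcs _ _))
    ((hcont ε' f' hf'1).integrable_of_hasCompactSupport (hcs _ _)) hdiff
  rw [Real.dist_eq, abs_lt] at hi ⊢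
  rw [abs_le] at e1
  constructor <;> linarith [hi.1, hi.2, e1.1, e1.2]

/-! ### The no-return property -/

/-- The radial velocity `⟨p, q⟩ / |q|`, the time derivative of `|q|`. -/
noncomputable def radialVelocity {d : ℕ} (x : Phase d) : ℝ :=
  inner ℝ (momentum x) (position x) / ‖position x‖

/-- The states beyond the radius `R` that move outward with radial energy at least the height
`u R` of the barrier.  Trajectories never leave this set. -/
noncomputable def escapeSet (d : ℕ) (u : ℝ → ℝ) (R : ℝ) : Set (Phase d) :=
  {x | R ≤ ‖position x‖ ∧ 0 ≤ radialVelocity x ∧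
    u R ≤ radialVelocity x ^ 2 / 2 + u ‖position x‖}

/-- The states that have escaped, together with those inside the radius `R` whose momentum is at
most `P`. -/
noncomputable def trapSet (d : ℕ) (u : ℝ → ℝ) (R P : ℝ) : Set (Phase d) :=
  escapeSet d u R ∪ {x | ‖position x‖ ≤ R ∧ ‖momentum x‖ ≤ P}

lemma isClosed_escapeSet {d : ℕ} {u : ℝ → ℝ} (hu : Continuous u) {R : ℝ} (hR : 0 < R) :
    IsClosed (escapeSet d u R) := by
  have hcl : IsClosed {x : Phase d | R ≤ ‖position x‖} :=
    isClosed_le continuous_const continuous_position.norm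
  have hw : ContinuousOn (radialVelocity (d := d)) {x : Phase d | R ≤ ‖position x‖} :=
    ((continuous_momentum.inner continuous_position).continuousOn).div
      continuous_position.norm.continuousOn fun x hx => (hR.trans_le hx).ne'
  have h2 : ContinuousOn (fun x : Phase d => radialVelocity x ^ 2 / 2 + u ‖position x‖)
      {x : Phase d | R ≤ ‖position x‖} :=
    ((hw.pow 2).div_const 2).add (hu.comp continuous_position.norm).continuousOn
  have := (hw.preimage_isClosed_of_isClosed hcl isClosed_Ici (t := Ici 0)).inter
    (h2.preimage_isClosed_of_isClosed hcl isClosed_Ici (t := Ici (u R)))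
  convert this using 1
  ext x
  simp only [escapeSet, mem_ofPred_eq, mem_inter_iff, mem_preimage, mem_Ici]
  tauto

lemma isClosed_trapSet {d : ℕ} {u : ℝ → ℝ} (hu : Continuous u) {R : ℝ} (hR : 0 < R) (P : ℝ) :
    IsClosed (trapSet d u R P) :=
  (isClosed_escapeSet hu hR).union
    ((isClosed_le continuous_position.norm continuous_const).inter
      (isClosed_le continuous_momentum.norm continuous_const))

/-- A positive one-sided derivative makes the function exceed its initial value right after. -/
lemma eventually_lt_of_hasDerivWithinAt_pos {f : ℝ → ℝ} {f' a : ℝ}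
    (hf : HasDerivWithinAt f f' (Ici a) a) (hpos : 0 < f') : ∀ᶠ t in 𝓝[>] a, f a < f t := by
  rw [← hasDerivWithinAt_Ioi_iff_Ici, hasDerivWithinAt_iff_tendsto_slope' self_notMem_Ioi] at hf
  filter_upwards [hf.eventually (lt_mem_nhds hpos), self_mem_nhdsWithin] with t ht hta
  rw [slope_def_field] at ht
  have h1 : 0 < t - a := sub_pos.2 hta
  have := (div_pos_iff_of_pos_right h1).1 ht
  linarith

lemma deriv_nonpos_of_forall_lt {u : ℝ → ℝ} {R : ℝ} (hu : DifferentiableAt ℝ u R)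
    (h : ∀ r, R < r → u r < u R) : deriv u R ≤ 0 := by
  by_contra hcon
  have := eventually_lt_of_hasDerivWithinAt_pos (hu.hasDerivAt.hasDerivWithinAt (s := Ici R))
    (not_le.1 hcon)
  obtain ⟨t, ht, hRt⟩ := (this.and self_mem_nhdsWithin).exists
  exact absurd (h t hRt) (not_lt.2 ht.le)

lemma exists_Ioc_of_eventually_nhdsGT {p : ℝ → Prop} {a b y : ℝ} (h : ∀ᶠ t in 𝓝[>] a, p t)
    (hab : a < b) (hay : a < y) : ∃ c ∈ Ioc a y, c ≤ b ∧ ∀ t ∈ Ioc a c, p t := by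
  obtain ⟨c, hc, hsub⟩ := mem_nhdsGT_iff_exists_Ioc_subset.1
    (h.and (Ioc_mem_nhdsGT (lt_min hab hay)))
  have hc' := (hsub (right_mem_Ioc.2 hc)).2
  exact ⟨c, ⟨hc, hc'.2.trans (min_le_right _ _)⟩, hc'.2.trans (min_le_left _ _),
    fun t ht => (hsub ht).1⟩

section Newton

variable {d : ℕ} {a : Pos d → Pos d} {v : Phase d → Phase d} {s R C : ℝ} {x : Phase d}
  {γ : ℝ → Phase d} {u : ℝ → ℝ}

lemma hasDerivWithinAt_position (hv : ∀ x, v x = phasePoint (-(a (position x))) (momentum x))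
    (hγ : IsTrajectory v s x γ) {t : ℝ} (ht : t ∈ Icc 0 s) :
    HasDerivWithinAt (fun t => position (γ t)) (momentum (γ t)) (Icc 0 s) t := by
  have := (positionL d).hasFDerivAt.comp_hasDerivWithinAt t (hγ.2 t ht)
  rwa [positionL_apply, hv, position_phasePoint] at this

lemma hasDerivWithinAt_momentum (hv : ∀ x, v x = phasePoint (-(a (position x))) (momentum x))
    (hγ : IsTrajectory v s x γ) {t : ℝ} (ht : t ∈ Icc 0 s) :
    HasDerivWithinAt (fun t => momentum (γ t)) (-(a (position (γ t)))) (Icc 0 s) t := by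
  have := (momentumL d).hasFDerivAt.comp_hasDerivWithinAt t (hγ.2 t ht)
  rwa [momentumL_apply, hv, momentum_phasePoint] at this

lemma hasDerivWithinAt_norm_position
    (hv : ∀ x, v x = phasePoint (-(a (position x))) (momentum x))
    (hγ : IsTrajectory v s x γ) {t : ℝ} (ht : t ∈ Icc 0 s) (h0 : 0 < ‖position (γ t)‖) :
    HasDerivWithinAt (fun t => ‖position (γ t)‖) (radialVelocity (γ t)) (Icc 0 s) t := by
  have h1 := ((hasDerivWithinAt_position hv hγ ht).norm_sq).sqrt (by positivity)
  have h2 : ∀ y, √(‖position (γ y)‖ ^ 2) = ‖position (γ y)‖ := fun y =>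
    Real.sqrt_sq (norm_nonneg _)
  simp only [h2] at h1
  refine h1.congr_deriv ?_
  rw [radialVelocity, real_inner_comm]
  field_simp

/-- Radial acceleration: the centrifugal term `(|p|² - w²) / |q|` is nonnegative, so a bound on the
radial force gives `ẇ > -u'(|q|)`. -/
lemma hasDerivWithinAt_radialVelocity
    (hv : ∀ x, v x = phasePoint (-(a (position x))) (momentum x))
    (hγ : IsTrajectory v s x γ) {t : ℝ} (ht : t ∈ Icc 0 s) (h0 : 0 < ‖position (γ t)‖)
    (ha : inner ℝ (a (position (γ t))) (position (γ t)) / ‖position (γ t)‖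
      < deriv u ‖position (γ t)‖) :
    ∃ w', 0 < w' + deriv u ‖position (γ t)‖ ∧
      HasDerivWithinAt (fun t => radialVelocity (γ t)) w' (Icc 0 s) t := by
  have h1 := ((hasDerivWithinAt_momentum hv hγ ht).inner ℝ (hasDerivWithinAt_position hv hγ ht)).div
    (hasDerivWithinAt_norm_position hv hγ ht h0) h0.ne'
  refine ⟨_, ?_, h1⟩
  set q := position (γ t)
  set p := momentum (γ t)
  have hr : radialVelocity (γ t) = inner ℝ p q / ‖q‖ := rfl
  rw [hr, inner_neg_left, real_inner_self_eq_norm_sq]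
  have hcs : inner ℝ p q ^ 2 ≤ ‖p‖ ^ 2 * ‖q‖ ^ 2 := by
    have := abs_real_inner_le_norm p q
    rw [← mul_pow, ← sq_abs]
    gcongr
  have hkey : ((‖p‖ ^ 2 + -inner ℝ (a q) q) * ‖q‖ - inner ℝ p q * (inner ℝ p q / ‖q‖)) / ‖q‖ ^ 2 =
      (‖p‖ ^ 2 * ‖q‖ ^ 2 - inner ℝ p q ^ 2) / ‖q‖ ^ 3 - inner ℝ (a q) q / ‖q‖ := by
    field_simp
    ring
  rw [hkey]
  have : 0 ≤ (‖p‖ ^ 2 * ‖q‖ ^ 2 - inner ℝ p q ^ 2) / ‖q‖ ^ 3 :=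
    div_nonneg (by linarith) (by positivity)
  linarith

/-- A trajectory in the escape set stays there for a short time: as long as the radial velocity is
nonnegative, the radius and the radial energy increase, and on the boundary of the set the radial
acceleration is positive. -/
lemma exists_mem_escapeSet (hv : ∀ x, v x = phasePoint (-(a (position x))) (momentum x))
    (hγ : IsTrajectory v s x γ) (hu : ContDiff ℝ 1 u) (hR : 0 < R)
    (hbar : ∀ r, R < r → u r < u R)
    (ha : ∀ q : Pos d, 0 < ‖q‖ → inner ℝ (a q) q / ‖q‖ < deriv u ‖q‖)
    {t y : ℝ} (ht : t ∈ Ico 0 s) (hy : t < y) (hmem : γ t ∈ escapeSet d u R) :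
    ∃ t' ∈ Ioc t y, γ t' ∈ escapeSet d u R := by
  have hud : Differentiable ℝ u := hu.differentiable (by norm_num)
  have htI : t ∈ Icc 0 s := Ico_subset_Icc_self ht
  have hnhds : Icc 0 s ∈ 𝓝[≥] t := mem_of_superset (Icc_mem_nhdsGE ht.2) (Icc_subset_Icc_left ht.1)
  have hρ0 : 0 < ‖position (γ t)‖ := hR.trans_le hmem.1
  obtain ⟨w', hw', hwd⟩ := hasDerivWithinAt_radialVelocity hv hγ htI hρ0 (ha _ hρ0)
  have hwd' := hwd.mono_of_mem_nhdsWithin hnhds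
  have hρd' := (hasDerivWithinAt_norm_position hv hγ htI hρ0).mono_of_mem_nhdsWithin hnhds
  have hIoi : 𝓝[>] t ≤ 𝓝[≥] t := nhdsWithin_mono _ Ioi_subset_Ici_self
  have ev1 : ∀ᶠ t' in 𝓝[>] t, 0 < ‖position (γ t')‖ :=
    (hρd'.continuousWithinAt.eventually (lt_mem_nhds hρ0)).filter_mono hIoi
  have ev2 : ∀ᶠ t' in 𝓝[>] t, 0 < radialVelocity (γ t') := by
    rcases hmem.2.1.eq_or_lt with h0 | hpos
    · -- Vanishing radial velocity in the escape set forces `|q| = R`, where `u' ≤ 0`.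
      have hρR : ‖position (γ t)‖ = R := by
        refine le_antisymm (not_lt.1 fun hlt => ?_) hmem.1
        have h1 := hbar _ hlt
        have h2 := hmem.2.2
        rw [← h0] at h2
        linarith
      have hu' := deriv_nonpos_of_forall_lt (hud R) hbar
      rw [hρR] at hw'
      have := eventually_lt_of_hasDerivWithinAt_pos hwd' (by linarith)
      rwa [← h0] at this
    · exact (hwd'.continuousWithinAt.eventually (lt_mem_nhds hpos)).filter_mono hIoi
  obtain ⟨c, hc, hcs, hcp⟩ := exists_Ioc_of_eventually_nhdsGT (ev1.and ev2) ht.2 hy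
  have hsub : Icc t c ⊆ Icc 0 s := Icc_subset_Icc ht.1 hcs
  have hpos : ∀ r ∈ Icc t c, 0 < ‖position (γ r)‖ ∧ 0 ≤ radialVelocity (γ r) := fun r hr => by
    rcases hr.1.eq_or_lt with rfl | hlt
    · exact ⟨hρ0, hmem.2.1⟩
    · exact ⟨(hcp r ⟨hlt, hr.2⟩).1, (hcp r ⟨hlt, hr.2⟩).2.le⟩
  have hρ : ∀ r ∈ Icc t c, HasDerivWithinAt (fun t => ‖position (γ t)‖) (radialVelocity (γ r))
      (Icc 0 s) r := fun r hr => hasDerivWithinAt_norm_position hv hγ (hsub hr) (hpos r hr).1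
  have hw : ∀ r ∈ Icc t c, ∃ w', 0 < w' + deriv u ‖position (γ r)‖ ∧
      HasDerivWithinAt (fun t => radialVelocity (γ t)) w' (Icc 0 s) r := fun r hr =>
    hasDerivWithinAt_radialVelocity hv hγ (hsub hr) (hpos r hr).1 (ha _ (hpos r hr).1)
  have hH : ∀ r ∈ Icc t c, ∃ e, 0 ≤ e ∧ HasDerivWithinAt
      (fun t => radialVelocity (γ t) ^ 2 / 2 + u ‖position (γ t)‖) e (Icc 0 s) r := by
    intro r hr
    obtain ⟨w', h1, h2⟩ := hw r hr
    refine ⟨radialVelocity (γ r) * (w' + deriv u ‖position (γ r)‖),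
      mul_nonneg (hpos r hr).2 h1.le, ?_⟩
    have h3 := ((h2.pow 2).div_const 2).add ((hud _).hasDerivAt.comp_hasDerivWithinAt r (hρ r hr))
    refine h3.congr_deriv ?_
    push_cast
    ring
  choose! e he0 he using hH
  have hint : ∀ r ∈ interior (Icc t c), r ∈ Icc t c := fun r hr => interior_subset hr
  have mono1 : MonotoneOn (fun t => ‖position (γ t)‖) (Icc t c) :=
    monotoneOn_of_hasDerivWithinAt_nonneg (convex_Icc t c)
      (fun r hr => (hρ r hr).continuousWithinAt.mono hsub)
      (fun r hr => (hρ r (hint r hr)).mono (interior_subset.trans hsub))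
      (fun r hr => (hpos r (hint r hr)).2)
  have mono2 : MonotoneOn (fun t => radialVelocity (γ t) ^ 2 / 2 + u ‖position (γ t)‖) (Icc t c) :=
    monotoneOn_of_hasDerivWithinAt_nonneg (convex_Icc t c)
      (fun r hr => (he r hr).continuousWithinAt.mono hsub)
      (fun r hr => (he r (hint r hr)).mono (interior_subset.trans hsub))
      (fun r hr => he0 r (hint r hr))
  have htc : t ∈ Icc t c := ⟨le_rfl, hc.1.le⟩
  have hcc : c ∈ Icc t c := ⟨hc.1.le, le_rfl⟩
  exact ⟨c, hc, hmem.1.trans (mono1 htc hcc hc.1.le), (hpos c hcc).2,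
    hmem.2.2.trans (mono2 htc hcc hc.1.le)⟩

/-- A trajectory that starts inside the radius `R` with momentum at most `P`, or has escaped,
remains in these alternatives, the momentum bound inside growing linearly. -/
theorem mem_trapSet (hv : ∀ x, v x = phasePoint (-(a (position x))) (momentum x))
    (hγ : IsTrajectory v s x γ) (hs : 0 ≤ s) (hu : ContDiff ℝ 1 u) (hR : 0 < R)
    (hbar : ∀ r, R < r → u r < u R)
    (ha : ∀ q : Pos d, 0 < ‖q‖ → inner ℝ (a q) q / ‖q‖ < deriv u ‖q‖)
    (hC : ∀ q : Pos d, ‖q‖ ≤ R → ‖a q‖ ≤ C) {P : ℝ} (hx : x ∈ trapSet d u R P) :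
    γ s ∈ trapSet d u R (P + C * s) := by
  have hqc : ContinuousOn (fun t => position (γ t)) (Icc 0 s) :=
    continuous_position.comp_continuousOn hγ.continuousOn
  have hpc : ContinuousOn (fun t => momentum (γ t)) (Icc 0 s) :=
    continuous_momentum.comp_continuousOn hγ.continuousOn
  have key : Icc 0 s ⊆ {t | γ t ∈ trapSet d u R (P + C * t)} := by
    refine IsClosed.Icc_subset_of_forall_exists_gt ?_ ?_ ?_
    · have h1 := hγ.continuousOn.preimage_isClosed_of_isClosed isClosed_Icc
        (isClosed_escapeSet (d := d) hu.continuous hR)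
      have h2 := hqc.norm.preimage_isClosed_of_isClosed isClosed_Icc (isClosed_Iic (a := R))
      have hlin : ContinuousOn (fun t => ‖momentum (γ t)‖ - (P + C * t)) (Icc 0 s) :=
        hpc.norm.sub (by fun_prop)
      have h3 := hlin.preimage_isClosed_of_isClosed isClosed_Icc (isClosed_Iic (a := (0 : ℝ)))
      have heq : {t | γ t ∈ trapSet d u R (P + C * t)} ∩ Icc 0 s =
          Icc 0 s ∩ γ ⁻¹' escapeSet d u R ∪
            (Icc 0 s ∩ (fun t => ‖position (γ t)‖) ⁻¹' Iic R) ∩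
            (Icc 0 s ∩ (fun t => ‖momentum (γ t)‖ - (P + C * t)) ⁻¹' Iic 0) := by
        ext t
        constructor
        · rintro ⟨h | h, ht⟩
          · exact Or.inl ⟨ht, h⟩
          · exact Or.inr ⟨⟨ht, h.1⟩, ht, sub_nonpos.2 h.2⟩
        · rintro (⟨ht, h⟩ | ⟨⟨ht, h⟩, -, h'⟩)
          · exact ⟨Or.inl h, ht⟩
          · exact ⟨Or.inr ⟨h, sub_nonpos.1 h'⟩, ht⟩
      rw [heq]
      exact h1.union (h2.inter h3)
    · show γ 0 ∈ trapSet d u R (P + C * 0)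
      rw [hγ.1, mul_zero, add_zero]
      exact hx
    · rintro t ⟨htm, ht⟩ y hy
      by_cases hE : γ t ∈ escapeSet d u R
      · obtain ⟨t', ht', hmem⟩ := exists_mem_escapeSet hv hγ hu hR hbar ha ht hy hE
        exact ⟨t', Or.inl hmem, ht'⟩
      have hin : ‖position (γ t)‖ ≤ R ∧ ‖momentum (γ t)‖ ≤ P + C * t := htm.resolve_left hE
      have htI : t ∈ Icc 0 s := Ico_subset_Icc_self ht
      have hnhds : Icc 0 s ∈ 𝓝[≥] t :=
        mem_of_superset (Icc_mem_nhdsGE ht.2) (Icc_subset_Icc_left ht.1)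
      have hIoi : 𝓝[>] t ≤ 𝓝[≥] t := nhdsWithin_mono _ Ioi_subset_Ici_self
      have ev : ∀ᶠ t' in 𝓝[>] t, ‖position (γ t')‖ ≤ R := by
        rcases hin.1.eq_or_lt with heq | hlt
        · -- On the sphere of radius `R`, a state that has not escaped moves strictly inward.
          have hw : radialVelocity (γ t) < 0 := by
            by_contra hcon
            refine hE ⟨heq.ge, not_lt.1 hcon, ?_⟩
            rw [heq]
            linarith [sq_nonneg (radialVelocity (γ t))]
          have hd := ((hasDerivWithinAt_norm_position hv hγ htI
            (by rw [heq]; exact hR)).mono_of_mem_nhdsWithin hnhds).fun_neg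
          filter_upwards [eventually_lt_of_hasDerivWithinAt_pos hd (by linarith)] with t' ht'
          linarith
        · have := ((hqc.norm t htI).mono_of_mem_nhdsWithin hnhds).eventually (gt_mem_nhds hlt)
          exact (this.filter_mono hIoi).mono fun _ h => le_of_lt h
      obtain ⟨c, hc, hcs, hcp⟩ := exists_Ioc_of_eventually_nhdsGT ev ht.2 hy
      refine ⟨c, Or.inr ⟨hcp c ⟨hc.1, le_rfl⟩, ?_⟩, hc⟩
      have hsub : Icc t c ⊆ Icc 0 s := Icc_subset_Icc ht.1 hcs
      have hbd := norm_image_sub_le_of_norm_deriv_right_le_segment (f := fun t => momentum (γ t))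
        (f' := fun t => -(a (position (γ t)))) (C := C) (hpc.mono hsub)
        (fun r hr => (hasDerivWithinAt_momentum hv hγ
          (hsub (Ico_subset_Icc_self hr))).mono_of_mem_nhdsWithin
            (mem_of_superset (Icc_mem_nhdsGE (hr.2.trans_le hcs))
              (Icc_subset_Icc_left (ht.1.trans hr.1))))
        (fun r hr => by
          rw [norm_neg]
          refine hC _ ?_
          rcases hr.1.eq_or_lt with rfl | hlt
          · exact hin.1
          · exact hcp r ⟨hlt, hr.2.le⟩) c ⟨hc.1.le, le_rfl⟩
      have := norm_sub_norm_le (momentum (γ c)) (momentum (γ t))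
      have h2 := hin.2
      linarith
  exact key ⟨hs, le_rfl⟩

end Newton

/-- The data extracted from the dynamical hypothesis: arbitrarily large barrier radii `R`, each
with a constant `C` such that the flow of every frozen field respects the sets `trapSet`. -/
lemma DynamicalHypothesis.exists_trap {d : ℕ} {W Φ : Pos d → ℝ} (hpot : AdmissiblePotentials W Φ)
    (hdyn : DynamicalHypothesis W Φ) : ∃ u : ℝ → ℝ, Continuous u ∧ ∀ R₀ : ℝ, ∃ R C : ℝ,
      R₀ < R ∧ 0 < R ∧ 0 ≤ C ∧ ∀ (μ : Measure (Phase d)) (s P : ℝ), μ univ ≤ 1 → 0 ≤ s →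
        ∀ x ∈ aliveSet (hamField W Φ μ) s, x ∈ trapSet d u R P →
          trajectory (hamField W Φ μ) s x s ∈ trapSet d u R (P + C * s) := by
  obtain ⟨B, hB, u, hu, hder, qs, -, hqs, hbar⟩ := hdyn
  obtain ⟨q₀, hq₀⟩ := hpot.exists_bound_gradient_W
  refine ⟨u, hu.continuous, fun R₀ => ?_⟩
  obtain ⟨L, hL⟩ := (hqs.eventually_gt_atTop (max R₀ 0)).exists
  have hR : 0 < ‖qs L‖ := (le_max_right _ _).trans_lt hL
  obtain ⟨C, hC⟩ := (isCompact_closedBall (0 : Pos d) ‖qs L‖).exists_bound_of_continuousOn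
    hpot.continuous_gradient_Φ.continuousOn
  refine ⟨‖qs L‖, ‖gradient W q₀‖ + |C|, (le_max_left _ _).trans_lt hL, hR, by positivity,
    fun μ s P hμ hs x hx hxt => ?_⟩
  have := isFiniteMeasure_of_le_one hμ
  refine mem_trapSet (a := fun q => meanForce W μ q + gradient Φ q)
    (fun y => hpot.hamField_eq y) (trajectory_isTrajectory hx) hs (hu.of_le (by norm_num)) hR
    (fun r hr => ?_) (fun q hq => ?_) (fun q hq => ?_) hxt
  · -- The barrier inequality is about radii: realize `r` by a multiple of the barrier point.
    have hn : ‖(r / ‖qs L‖) • qs L‖ = r := by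
      rw [norm_smul, Real.norm_eq_abs, abs_of_pos (div_pos (hR.trans hr) hR)]
      field_simp
    have := hbar L ((r / ‖qs L‖) • qs L) (by rw [hn]; exact hr)
    rwa [hn] at this
  · have he : ‖(‖q‖⁻¹ • q)‖ = 1 := by
      rw [norm_smul, norm_inv, norm_norm, inv_mul_cancel₀ hq.ne']
    have hre : ‖q‖ • (‖q‖⁻¹ • q) = q := by rw [smul_smul, mul_inv_cancel₀ hq.ne', one_smul]
    have h1 := hder ‖q‖ hq.le _ he
    rw [hre] at h1
    have h2 : inner ℝ (meanForce W μ q) (‖q‖⁻¹ • q) ≤ ‖gradient W q₀‖ := by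
      refine (real_inner_le_norm _ _).trans ?_
      rw [he, mul_one]
      exact AdmissiblePotentials.norm_meanForce_le hq₀ hμ q
    have h3 : inner ℝ (meanForce W μ q + gradient Φ q) q / ‖q‖ =
        inner ℝ (meanForce W μ q) (‖q‖⁻¹ • q) + inner ℝ (gradient Φ q) (‖q‖⁻¹ • q) := by
      rw [← inner_add_left, inner_smul_right]
      field_simp
    rw [h3]
    linarith [hB q₀]
  · have h1 := norm_add_le (meanForce W μ q) (gradient Φ q)
    have h2 := AdmissiblePotentials.norm_meanForce_le hq₀ hμ q
    have h3 := (hC q (by simpa using hq)).trans (le_abs_self C)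
    linarith

/-! ### The time discretization -/

section Discretization

variable {d : ℕ} {W Φ : Pos d → ℝ} {ε h : ℝ} {μ₀ : Measure (Phase d)}

lemma discreteNode_univ_le (hpot : AdmissiblePotentials W Φ) (hε : 0 ≤ ε) (hh : 0 ≤ h)
    (hμ₀ : μ₀ univ ≤ 1) (k : ℕ) : discreteNode W Φ ε h μ₀ k univ ≤ 1 := by
  induction k with
  | zero => exact hμ₀
  | succ k ih =>
    exact (deficientEvolution_univ_le (hpot.locallyLipschitz_hamField ih) hh hε).trans ih

lemma discretized_eq (hh : 0 < h) {k : ℕ} {t : ℝ} (ht : t ∈ Icc (k * h) ((k + 1) * h)) :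
    discretized W Φ ε h μ₀ t = deficientEvolution ε (hamField W Φ (discreteNode W Φ ε h μ₀ k))
      (t - k * h) (discreteNode W Φ ε h μ₀ k) := by
  have ht0 : 0 ≤ t := le_trans (by positivity) ht.1
  rcases ht.2.lt_or_eq with hlt | rfl
  · have hfl : ⌊t / h⌋₊ = k := by
      rw [Nat.floor_eq_iff (by positivity)]
      exact ⟨(le_div_iff₀ hh).2 ht.1, (div_lt_iff₀ hh).2 hlt⟩
    rw [discretized, hfl]
  · have hfl : ⌊((k : ℝ) + 1) * h / h⌋₊ = k + 1 := by
      rw [mul_div_cancel_right₀ _ hh.ne']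
      exact_mod_cast Nat.floor_natCast (k + 1)
    rw [discretized, hfl]
    push_cast
    rw [sub_self, deficientEvolution_zero, discreteNode]
    congr 1
    ring

lemma discretized_node (hh : 0 < h) (k : ℕ) :
    discretized W Φ ε h μ₀ (k * h) = discreteNode W Φ ε h μ₀ k := by
  rw [discretized_eq hh (k := k) ⟨le_rfl, by nlinarith⟩, sub_self, deficientEvolution_zero]

lemma mem_Icc_floor (hh : 0 < h) {t : ℝ} (ht : 0 ≤ t) :
    t ∈ Icc (⌊t / h⌋₊ * h) ((⌊t / h⌋₊ + 1) * h) :=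
  ⟨(le_div_iff₀ hh).1 (Nat.floor_le (by positivity)),
    ((div_lt_iff₀ hh).1 (Nat.lt_floor_add_one (t / h))).le⟩

lemma discretized_univ_le (hpot : AdmissiblePotentials W Φ) (hε : 0 ≤ ε) (hh : 0 < h)
    (hμ₀ : μ₀ univ ≤ 1) {t : ℝ} (ht : 0 ≤ t) : discretized W Φ ε h μ₀ t univ ≤ 1 := by
  have hk := mem_Icc_floor hh ht
  have h1 := discreteNode_univ_le hpot hε hh.le hμ₀ ⌊t / h⌋₊
  rw [discretized_eq hh hk]
  exact (deficientEvolution_univ_le (hpot.locallyLipschitz_hamField h1) (sub_nonneg.2 hk.1)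
    hε).trans h1

/-- The mass outside the trap sets does not increase along the discretization, because each frozen
flow maps trap sets to trap sets. -/
lemma discretized_compl_trapSet_le (hpot : AdmissiblePotentials W Φ) (hε : 0 ≤ ε) (hh : 0 < h)
    (hμ₀ : μ₀ univ ≤ 1) {u : ℝ → ℝ} (hu : Continuous u) {R C : ℝ} (hR : 0 < R)
    (htrap : ∀ (μ : Measure (Phase d)) (s P : ℝ), μ univ ≤ 1 → 0 ≤ s →
        ∀ x ∈ aliveSet (hamField W Φ μ) s, x ∈ trapSet d u R P →
          trajectory (hamField W Φ μ) s x s ∈ trapSet d u R (P + C * s)) (P : ℝ) {t : ℝ}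
    (ht : 0 ≤ t) :
    discretized W Φ ε h μ₀ t (trapSet d u R (P + C * t))ᶜ ≤ μ₀ (trapSet d u R P)ᶜ := by
  have hmass := discreteNode_univ_le hpot hε hh.le hμ₀
  have step : ∀ k s, 0 ≤ s → deficientEvolution ε (hamField W Φ (discreteNode W Φ ε h μ₀ k)) s
      (discreteNode W Φ ε h μ₀ k) (trapSet d u R (P + C * (k * h + s)))ᶜ ≤
      discreteNode W Φ ε h μ₀ k (trapSet d u R (P + C * (k * h)))ᶜ := by
    intro k s hs
    refine deficientEvolution_apply_le (hpot.locallyLipschitz_hamField (hmass k)) hs hε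
      (isClosed_trapSet hu hR _).isOpen_compl.measurableSet fun x hx hxS hxA => hxS ?_
    have := htrap _ s _ (hmass k) hs x hx hxA
    rwa [add_assoc, ← mul_add] at this
  have node : ∀ k : ℕ, discreteNode W Φ ε h μ₀ k (trapSet d u R (P + C * (k * h)))ᶜ ≤
      μ₀ (trapSet d u R P)ᶜ := by
    intro k
    induction k with
    | zero => simp [discreteNode]
    | succ k ih =>
      refine le_trans ?_ ih
      have hkh : ((k + 1 : ℕ) : ℝ) * h = k * h + h := by push_cast; ring
      rw [discreteNode, hkh]
      exact step k h hh.le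
  have hk := mem_Icc_floor hh ht
  rw [discretized_eq hh hk]
  have := step ⌊t / h⌋₊ (t - ⌊t / h⌋₊ * h) (sub_nonneg.2 hk.1)
  rw [add_sub_cancel] at this
  exact this.trans (node _)

/-- All discretized measures on `[0, T]`, for all deficiencies and step sizes, lie in one momentum
tight set that is closed under distributional limits. -/
theorem exists_momentumTight_discretized (hpot : AdmissiblePotentials W Φ)
    (hdyn : DynamicalHypothesis W Φ) (hμ₀ : μ₀ univ ≤ 1) (T : ℝ) :
    ∃ S : Set (Measure (Phase d)), MomentumTight S ∧
      (∀ ε h t : ℝ, 0 ≤ ε → 0 < h → t ∈ Icc 0 T → discretized W Φ ε h μ₀ t ∈ S) ∧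
      ∀ (m : ℕ → Measure (Phase d)) (ν : Measure (Phase d)), IsFiniteMeasure ν →
        (∀ k, m k univ ≤ 1) → (∀ k, m k ∈ S) → DistTendsto m atTop ν → ν ∈ S := by
  have := isFiniteMeasure_of_le_one hμ₀
  obtain ⟨u, hu, htrap⟩ := hdyn.exists_trap hpot
  have key : ∀ R δ : ℝ, 0 < δ → ∃ P : ℝ, ∀ ε h t : ℝ, 0 ≤ ε → 0 < h → t ∈ Icc 0 T →
      discretized W Φ ε h μ₀ t {x | ‖position x‖ < R ∧ P < ‖momentum x‖} ≤ ENNReal.ofReal δ := by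
    intro R δ hδ
    obtain ⟨K, -, hK, hKδ⟩ := MeasurableSet.univ.exists_isCompact_sdiff_lt
      (measure_ne_top μ₀ univ) (ENNReal.ofReal_pos.2 hδ).ne'
    obtain ⟨N, hN⟩ := hK.isBounded.exists_norm_le
    -- The barrier radius exceeds both `R` and the size of a compact set carrying almost all of `μ₀`.
    obtain ⟨R', C, hRR', hR', hC, htr⟩ := htrap (max R N)
    refine ⟨N + C * T, fun ε h t hε hh ht => ?_⟩
    refine (measure_mono ?_).trans ((discretized_compl_trapSet_le hpot hε hh hμ₀ hu hR' htr N
      ht.1).trans ((measure_mono ?_).trans hKδ.le))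
    · rintro x ⟨hx1, hx2⟩ (hx | hx)
      · linarith [hx.1, le_max_left R N]
      · have : C * t ≤ C * T := by gcongr; exact ht.2
        linarith [hx.2]
    · refine fun x hx => ⟨mem_univ x, fun hxK => hx (Or.inr ?_)⟩
      have h1 := hN x hxK
      exact ⟨by linarith [norm_position_le x, le_max_right R N], (norm_momentum_le x).trans h1⟩
  choose! P hP using key
  refine ⟨{μ | ∀ R δ : ℝ, 0 < δ → μ {x | ‖position x‖ < R ∧ P R δ < ‖momentum x‖} ≤
    ENNReal.ofReal δ}, fun R δ hδ => ⟨P R δ, fun μ hμ => hμ R δ hδ⟩,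
    fun ε h t hε hh ht R δ hδ => hP R δ hδ ε h t hε hh ht, fun m ν _ hm hmS hconv R δ hδ => ?_⟩
  exact hconv.measure_le_of_isOpen (Eventually.of_forall hm) (isOpen_tail _ _)
    (Eventually.of_forall fun k => hmS k R δ hδ)

lemma deficientGenerator_shift (ε : ℝ) (v : Phase d → Phase d) (φ : ℝ × Phase d → ℝ) (a t : ℝ)
    (x : Phase d) : deficientGenerator ε v (fun z => φ ((a, 0) + z)) (t, x) =
      deficientGenerator ε v φ (a + t, x) := by
  simp [deficientGenerator, fderiv_comp_add_left]

variable {φ : ℝ × Phase d → ℝ} {K : Set (Phase d)} {T C : ℝ}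

/-- The integrals of a test function against the discretized measures are Lipschitz in time. -/
lemma abs_integral_discretized_sub_le (hpot : AdmissiblePotentials W Φ) (hε : 0 ≤ ε) (hh : 0 < h)
    (hμ₀ : μ₀ univ ≤ 1) (hφ : ContDiff ℝ 1 φ) (hK : IsCompact K)
    (hφK : ∀ t x, x ∉ K → φ (t, x) = 0) (hC : 0 ≤ C)
    (hgen : ∀ μ : Measure (Phase d), μ univ ≤ 1 → ∀ t ∈ Icc 0 T, ∀ x,
      |deficientGenerator ε (hamField W Φ μ) φ (t, x)| ≤ C) {s t : ℝ} (hs : 0 ≤ s) (hst : s ≤ t)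
    (ht : t ≤ T) :
    |∫ x, φ (t, x) ∂(discretized W Φ ε h μ₀ t) - ∫ x, φ (s, x) ∂(discretized W Φ ε h μ₀ s)|
      ≤ C * (t - s) := by
  have hmass := discreteNode_univ_le hpot hε hh.le hμ₀
  have local_ : ∀ (k : ℕ) (s t : ℝ), k * h ≤ s → s ≤ t → t ≤ (k + 1) * h → t ≤ T →
      |∫ x, φ (t, x) ∂(discretized W Φ ε h μ₀ t) - ∫ x, φ (s, x) ∂(discretized W Φ ε h μ₀ s)|
      ≤ C * (t - s) := by
    intro k s t hks hst htk htT
    have hk0 : 0 ≤ k * h := by positivity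
    have := abs_integral_deficientEvolution_sub_le (hmass k)
      (hpot.locallyLipschitz_hamField (hmass k)) hε (φ := fun z => φ ((k * h, 0) + z))
      (hφ.comp (by fun_prop)) hK
      (fun t x hx => by rw [Prod.mk_add_mk, zero_add]; exact hφK _ _ hx) (S := T - k * h) hC
      (fun r hr x => by
        rw [deficientGenerator_shift]
        exact hgen _ (hmass k) _ ⟨by linarith [hr.1], by linarith [hr.2]⟩ x)
      (s := s - k * h) (s' := t - k * h) (by linarith) (by linarith) (by linarith)
    simp only [Prod.mk_add_mk, zero_add, add_sub_cancel] at this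
    rw [discretized_eq hh (k := k) ⟨hks.trans hst, htk⟩,
      discretized_eq hh (k := k) ⟨hks, hst.trans htk⟩]
    convert this using 2
    ring
  have glue : ∀ (k : ℕ) (s t : ℝ), 0 ≤ s → s ≤ t → t ≤ k * h → t ≤ T →
      |∫ x, φ (t, x) ∂(discretized W Φ ε h μ₀ t) - ∫ x, φ (s, x) ∂(discretized W Φ ε h μ₀ s)|
      ≤ C * (t - s) := by
    intro k
    induction k with
    | zero =>
      intro s t hs hst ht _
      have : t = s := by
        simp only [Nat.cast_zero, zero_mul] at ht
        linarith
      simp [this]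
    | succ k ih =>
      intro s t hs hst ht htT
      push_cast at ht
      rcases le_or_gt t (k * h) with h1 | h1
      · exact ih s t hs hst h1 htT
      rcases le_or_gt (k * h) s with h2 | h2
      · exact local_ k s t h2 hst ht htT
      have e1 := local_ k (k * h) t le_rfl h1.le ht htT
      have e2 := ih s (k * h) hs h2.le le_rfl (h1.le.trans htT)
      refine (abs_sub_le _ _ _).trans ((add_le_add e1 e2).trans_eq ?_)
      ring
  exact glue (⌊t / h⌋₊ + 1) s t hs hst
    (by push_cast; exact (mem_Icc_floor hh (hs.trans hst)).2) ht

/-- The weak form of the discretized equation, as a right derivative valid also at the nodes. -/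
lemma hasDerivWithinAt_integral_discretized (hpot : AdmissiblePotentials W Φ) (hε : 0 ≤ ε)
    (hh : 0 < h) (hμ₀ : μ₀ univ ≤ 1) (hφ : ContDiff ℝ 1 φ) (hK : IsCompact K)
    (hφK : ∀ t x, x ∉ K → φ (t, x) = 0) (hC : 0 ≤ C)
    (hgen : ∀ μ : Measure (Phase d), μ univ ≤ 1 → ∀ t ∈ Icc 0 T, ∀ x,
      |deficientGenerator ε (hamField W Φ μ) φ (t, x)| ≤ C) {t : ℝ} (ht : 0 ≤ t) (htT : t < T) :
    HasDerivWithinAt (fun t => ∫ x, φ (t, x) ∂(discretized W Φ ε h μ₀ t))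
      (∫ x, deficientGenerator ε (hamField W Φ (discreteNode W Φ ε h μ₀ ⌊t / h⌋₊)) φ (t, x)
        ∂(discretized W Φ ε h μ₀ t)) (Ici t) t := by
  have hmass := discreteNode_univ_le hpot hε hh.le hμ₀
  have hk := mem_Icc_floor hh ht
  have hlt : t < (⌊t / h⌋₊ + 1) * h := (div_lt_iff₀ hh).1 (Nat.lt_floor_add_one (t / h))
  set k := ⌊t / h⌋₊
  have hk0 : 0 ≤ k * h := by positivity
  have hd := hasDerivWithinAt_integral_deficientEvolution (hmass k)
    (hpot.locallyLipschitz_hamField (hmass k)) hε (φ := fun z => φ ((k * h, 0) + z))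
    (hφ.comp (by fun_prop)) hK
    (fun t x hx => by rw [Prod.mk_add_mk, zero_add]; exact hφK _ _ hx) (S := T - k * h) hC
    (fun r hr x => by
      rw [deficientGenerator_shift]
      exact hgen _ (hmass k) _ ⟨by linarith [hr.1], by linarith [hr.2]⟩ x)
    (s := t - k * h) (sub_nonneg.2 hk.1) (by linarith)
  have hcomp := hd.scomp t (((hasDerivAt_id t).sub_const (k * h)).hasDerivWithinAt (s := Ici t))
    (fun y hy => sub_le_sub_right hy _)
  simp only [one_smul, deficientGenerator_shift, add_sub_cancel] at hcomp
  have heq : ∀ r ∈ Icc t ((k + 1) * h), ∫ x, φ (r, x) ∂(discretized W Φ ε h μ₀ r) =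
      ((fun s => ∫ x, φ ((k * h, 0) + (s, x)) ∂(deficientEvolution ε
        (hamField W Φ (discreteNode W Φ ε h μ₀ k)) s (discreteNode W Φ ε h μ₀ k))) ∘
        fun r => id r - k * h) r := by
    intro r hr
    rw [discretized_eq hh (k := k) ⟨hk.1.trans hr.1, hr.2⟩]
    simp only [Function.comp, id, Prod.mk_add_mk, zero_add, add_sub_cancel]
  rw [discretized_eq hh hk]
  refine hcomp.congr_of_eventuallyEq ?_ (heq t ⟨le_rfl, hlt.le⟩)
  filter_upwards [Icc_mem_nhdsGE hlt] with r hr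
  exact heq r hr

end Discretization

/-! ### Weak solutions and their stability -/

/-- The time-integrated weak form, tested against `φ`, of the deficient continuity equation for
the curve `m` with the field generated by the curve `f`. -/
noncomputable def IsWeakSolution {d : ℕ} (W Φ : Pos d → ℝ) (T ε : ℝ) (φ : ℝ × Phase d → ℝ)
    (m f : ℝ → Measure (Phase d)) : Prop :=
  AEStronglyMeasurable
    (fun t => ∫ x, deficientGenerator ε (hamField W Φ (f t)) φ (t, x) ∂(m t))
    (volume.restrict (Ioc 0 T)) ∧
  ∫ t in Ioc 0 T, ∫ x, deficientGenerator ε (hamField W Φ (f t)) φ (t, x) ∂(m t) = 0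

section Stability

variable {d : ℕ} {W Φ : Pos d → ℝ} {φ : ℝ × Phase d → ℝ} {K : Set (Phase d)} {T : ℝ}

lemma isWeakSolution_discretized (hpot : AdmissiblePotentials W Φ) {ε h : ℝ} (hε : 0 ≤ ε)
    (hh : 0 < h) {μ₀ : Measure (Phase d)} (hμ₀ : μ₀ univ ≤ 1) (hT : 0 ≤ T) (hφ : ContDiff ℝ 1 φ)
    (hK : IsCompact K) (hφK : ∀ t x, x ∉ K → φ (t, x) = 0) (hφ0 : ∀ x, φ (0, x) = 0)
    (hφT : ∀ x, φ (T, x) = 0) :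
    IsWeakSolution W Φ T ε φ (discretized W Φ ε h μ₀)
      (fun t => discreteNode W Φ ε h μ₀ ⌊t / h⌋₊) := by
  obtain ⟨C, hC, hgen⟩ := hpot.exists_bound_generator hφ hK hφK T ε
  replace hgen := hgen ε hε le_rfl
  set g : ℝ → ℝ := fun t => ∫ x, φ (t, x) ∂(discretized W Φ ε h μ₀ t) with hg
  set G : ℝ → ℝ := fun t => ∫ x, deficientGenerator ε
    (hamField W Φ (discreteNode W Φ ε h μ₀ ⌊t / h⌋₊)) φ (t, x) ∂(discretized W Φ ε h μ₀ t) with hG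
  have hder : ∀ t ∈ Ico 0 T, HasDerivWithinAt g (G t) (Ici t) t := fun t ht =>
    hasDerivWithinAt_integral_discretized hpot hε hh hμ₀ hφ hK hφK hC hgen ht.1 ht.2
  have hcont : ContinuousOn g (Icc 0 T) := by
    have : LipschitzOnWith C.toNNReal g (Icc 0 T) := by
      refine LipschitzOnWith.of_dist_le_mul fun s hs t ht => ?_
      rw [Real.coe_toNNReal C hC, Real.dist_eq, Real.dist_eq]
      rcases le_total s t with hst | hst
      · rw [abs_sub_comm, abs_sub_comm s, abs_of_nonneg (sub_nonneg.2 hst)]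
        exact abs_integral_discretized_sub_le hpot hε hh hμ₀ hφ hK hφK hC hgen hs.1 hst ht.2
      · rw [abs_of_nonneg (sub_nonneg.2 hst)]
        exact abs_integral_discretized_sub_le hpot hε hh hμ₀ hφ hK hφK hC hgen ht.1 hst hs.2
    exact this.continuousOn
  have hmeas : AEStronglyMeasurable G (volume.restrict (Ioc 0 T)) := by
    have h1 : AEStronglyMeasurable (fun t => derivWithin g (Ici t) t) (volume.restrict (Ioo 0 T)) :=
      (measurable_derivWithin_Ici g).aestronglyMeasurable
    rw [← restrict_Ioo_eq_restrict_Ioc]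
    refine h1.congr ?_
    filter_upwards [ae_restrict_mem measurableSet_Ioo] with t ht
    exact (hder t ⟨ht.1.le, ht.2⟩).derivWithin (uniqueDiffWithinAt_Ici t)
  have hbound : ∀ t ∈ Ioc 0 T, ‖G t‖ ≤ C := fun t ht =>
    norm_integral_le_of_mass_le_one (discretized_univ_le hpot hε hh hμ₀ ht.1.le) hC
      (hgen _ (discreteNode_univ_le hpot hε hh.le hμ₀ _) t (Ioc_subset_Icc_self ht))
  have hint : IntegrableOn G (Ioc 0 T) :=
    Integrable.of_bound hmeas C ((ae_restrict_mem measurableSet_Ioc).mono hbound)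
  refine ⟨hmeas, ?_⟩
  have hftc := intervalIntegral.integral_eq_sub_of_hasDeriv_right_of_le hT hcont
    (fun t ht => (hasDerivWithinAt_Ioi_iff_Ici).2 (hder t ⟨ht.1.le, ht.2⟩))
    ((intervalIntegrable_iff_integrableOn_Ioc_of_le hT).2 hint)
  rw [intervalIntegral.integral_of_le hT] at hftc
  rw [hftc]
  simp [hg, hφ0, hφT]

/-- Weak solutions are stable under distributional convergence at each time, provided that the
measures generating the field are momentum tight. -/
lemma isWeakSolution_of_tendsto (hpot : AdmissiblePotentials W Φ)
    {m f : ℕ → ℝ → Measure (Phase d)} {m' f' : ℝ → Measure (Phase d)} {ε : ℕ → ℝ} {ε' ε₀ : ℝ}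
    (hε0 : ∀ k, 0 ≤ ε k) (hεle : ∀ k, ε k ≤ ε₀) (hε : Tendsto ε atTop (𝓝 ε'))
    (hm : ∀ t ∈ Icc 0 T, DistTendsto (fun k => m k t) atTop (m' t))
    (hf : ∀ t ∈ Icc 0 T, DistTendsto (fun k => f k t) atTop (f' t))
    (hm1 : ∀ k, ∀ t ∈ Icc 0 T, m k t univ ≤ 1) (hf1 : ∀ k, ∀ t ∈ Icc 0 T, f k t univ ≤ 1)
    (hm'1 : ∀ t ∈ Icc 0 T, m' t univ ≤ 1) (hf'1 : ∀ t ∈ Icc 0 T, f' t univ ≤ 1)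
    {S : Set (Measure (Phase d))} (hS : MomentumTight S) (hfS : ∀ k, ∀ t ∈ Icc 0 T, f k t ∈ S)
    (hφ : ContDiff ℝ 1 φ) (hK : IsCompact K) (hφK : ∀ t x, x ∉ K → φ (t, x) = 0)
    (hweak : ∀ k, IsWeakSolution W Φ T (ε k) φ (m k) (f k)) :
    IsWeakSolution W Φ T ε' φ m' f' := by
  obtain ⟨C, hC, hgen⟩ := hpot.exists_bound_generator hφ hK hφK T ε₀
  have hlim : ∀ᵐ t ∂(volume.restrict (Ioc 0 T)), Tendsto
      (fun k => ∫ x, deficientGenerator (ε k) (hamField W Φ (f k t)) φ (t, x) ∂(m k t)) atTop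
      (𝓝 (∫ x, deficientGenerator ε' (hamField W Φ (f' t)) φ (t, x) ∂(m' t))) := by
    filter_upwards [ae_restrict_mem measurableSet_Ioc] with t ht
    have ht' := Ioc_subset_Icc_self ht
    exact hpot.tendsto_integral_generator (hm t ht') (hf t ht') hε
      (Eventually.of_forall fun k => hm1 k t ht') (Eventually.of_forall fun k => hf1 k t ht')
      (hm'1 t ht') (hf'1 t ht') hS (Eventually.of_forall fun k => hfS k t ht') hφ hK hφK t
  refine ⟨aestronglyMeasurable_of_tendsto_ae atTop (fun k => (hweak k).1) hlim, ?_⟩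
  have h1 := tendsto_integral_of_dominated_convergence (fun _ => C) (fun k => (hweak k).1)
    (integrable_const C) (fun k => by
      filter_upwards [ae_restrict_mem measurableSet_Ioc] with t ht
      have ht' := Ioc_subset_Icc_self ht
      exact norm_integral_le_of_mass_le_one (hm1 k t ht') hC
        (hgen _ (hε0 k) (hεle k) _ (hf1 k t ht') t ht')) hlim
  simp only [fun k => (hweak k).2] at h1
  exact (tendsto_nhds_unique h1 tendsto_const_nhds)

end Stability

/-! ### Deficient solutions and the vanishing deficiency limit -/

/-- Equi-Lipschitz estimate for time-independent test functions, uniform for bounded deficiency. -/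
lemma AdmissiblePotentials.exists_lipschitz_discretized {d : ℕ} {W Φ : Pos d → ℝ}
    (hpot : AdmissiblePotentials W Φ) {μ₀ : Measure (Phase d)} (hμ₀ : μ₀ univ ≤ 1) (T ε₀ : ℝ)
    {ψ : Phase d → ℝ} (hψ : ContDiff ℝ ∞ ψ) (hψc : HasCompactSupport ψ) :
    ∃ C : ℝ, 0 ≤ C ∧ ∀ ε h : ℝ, 0 ≤ ε → ε ≤ ε₀ → 0 < h → ∀ s ∈ Icc 0 T, ∀ t ∈ Icc 0 T,
      |∫ x, ψ x ∂(discretized W Φ ε h μ₀ t) - ∫ x, ψ x ∂(discretized W Φ ε h μ₀ s)|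
        ≤ C * |t - s| := by
  have hφ : ContDiff ℝ 1 fun z : ℝ × Phase d => ψ z.2 :=
    (hψ.of_le (by exact_mod_cast le_top)).comp contDiff_snd
  have hφK : ∀ (t : ℝ) (x : Phase d), x ∉ tsupport ψ →
      (fun z : ℝ × Phase d => ψ z.2) (t, x) = 0 := fun t x hx => image_eq_zero_of_notMem_tsupport hx
  obtain ⟨C, hC, hgen⟩ := hpot.exists_bound_generator hφ hψc hφK T ε₀
  refine ⟨C, hC, fun ε h hε hεε₀ hh s hs t ht => ?_⟩
  rcases le_total s t with hst | hst
  · rw [abs_of_nonneg (sub_nonneg.2 hst)]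
    exact abs_integral_discretized_sub_le hpot hε hh hμ₀ hφ hψc hφK hC (hgen ε hε hεε₀) hs.1 hst
      ht.2
  · rw [abs_sub_comm, abs_sub_comm t, abs_of_nonneg (sub_nonneg.2 hst)]
    exact abs_integral_discretized_sub_le hpot hε hh hμ₀ hφ hψc hφK hC (hgen ε hε hεε₀) ht.1 hst
      hs.2

theorem exists_isDiscretizationLimit {d : ℕ} {W Φ : Pos d → ℝ} (hpot : AdmissiblePotentials W Φ)
    {T : ℝ} (hT : 0 < T) {μ₀ : Measure (Phase d)} (hμ₀ : μ₀ univ ≤ 1) {ε : ℝ} (hε : 0 ≤ ε) :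
    ∃ μ : ℝ → Measure (Phase d), IsDiscretizationLimit W Φ T ε μ₀ μ := by
  have hstep : ∀ n : ℕ, 0 < T / ((n + 1 : ℕ) : ℝ) := fun n => by positivity
  obtain ⟨σ, hσ, ν, hν1, hν⟩ := exists_subseq_distTendsto hT.le
    (fun n => discretized W Φ ε (T / ((n + 1 : ℕ) : ℝ)) μ₀)
    (fun n t ht => discretized_univ_le hpot hε (hstep n) hμ₀ ht.1)
    (fun ψ hψ hψc => by
      obtain ⟨C, -, h⟩ := hpot.exists_lipschitz_discretized hμ₀ T ε hψ hψc
      exact ⟨C, fun n s hs t ht => h ε _ hε le_rfl (hstep n) s hs t ht⟩)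
  exact ⟨ν, fun t _ => isFiniteMeasure_of_le_one (hν1 t), fun k => σ k + 1,
    fun a b hab => Nat.succ_lt_succ (hσ hab), fun k => Nat.succ_pos _, hν⟩

namespace IsDiscretizationLimit

variable {d : ℕ} {W Φ : Pos d → ℝ} {T ε : ℝ} {μ₀ : Measure (Phase d)} {μ : ℝ → Measure (Phase d)}

lemma univ_le_one (hμ : IsDiscretizationLimit W Φ T ε μ₀ μ) (hpot : AdmissiblePotentials W Φ)
    (hT : 0 < T) (hμ₀ : μ₀ univ ≤ 1) (hε : 0 ≤ ε) {t : ℝ} (ht : t ∈ Icc 0 T) : μ t univ ≤ 1 := by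
  obtain ⟨hfin, n, -, hn0, hn⟩ := hμ
  have := hfin t ht
  exact (hn t ht).measure_univ_le_one (Eventually.of_forall fun k =>
    discretized_univ_le hpot hε (div_pos hT (Nat.cast_pos.2 (hn0 k))) hμ₀ ht.1)

lemma apply_zero (hμ : IsDiscretizationLimit W Φ T ε μ₀ μ) (hT : 0 < T) (hμ₀ : μ₀ univ ≤ 1) :
    μ 0 = μ₀ := by
  obtain ⟨hfin, n, -, hn0, hn⟩ := hμ
  have h0 : (0 : ℝ) ∈ Icc 0 T := ⟨le_rfl, hT.le⟩
  have := hfin 0 h0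
  have := isFiniteMeasure_of_le_one hμ₀
  have hd : ∀ k, discretized W Φ ε (T / n k) μ₀ 0 = μ₀ := fun k => by
    have := discretized_node (W := W) (Φ := Φ) (ε := ε) (μ₀ := μ₀)
      (div_pos hT (Nat.cast_pos.2 (hn0 k))) 0
    simpa [discreteNode] using this
  have h1 := hn 0 h0
  simp only [hd] at h1
  exact h1.unique (fun φ _ _ => tendsto_const_nhds) (Eventually.of_forall fun _ => hμ₀)

lemma lipschitz (hμ : IsDiscretizationLimit W Φ T ε μ₀ μ) (hT : 0 < T)
    {ψ : Phase d → ℝ} (hψ : ContDiff ℝ ∞ ψ) (hψc : HasCompactSupport ψ) {C : ℝ}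
    (hC : ∀ h : ℝ, 0 < h → ∀ s ∈ Icc 0 T, ∀ t ∈ Icc 0 T,
      |∫ x, ψ x ∂(discretized W Φ ε h μ₀ t) - ∫ x, ψ x ∂(discretized W Φ ε h μ₀ s)|
        ≤ C * |t - s|) {s t : ℝ} (hs : s ∈ Icc 0 T) (ht : t ∈ Icc 0 T) :
    |∫ x, ψ x ∂(μ t) - ∫ x, ψ x ∂(μ s)| ≤ C * |t - s| := by
  obtain ⟨-, n, -, hn0, hn⟩ := hμ
  exact le_of_tendsto (((hn t ht ψ hψ hψc).sub (hn s hs ψ hψ hψc)).abs)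
    (Eventually.of_forall fun k => hC _ (div_pos hT (Nat.cast_pos.2 (hn0 k))) s hs t ht)

/-- A deficient solution solves the weak deficient equation: the nodes that generate the field of
the discretization have the same limit as the discretized measures. -/
lemma isWeakSolution (hμ : IsDiscretizationLimit W Φ T ε μ₀ μ) (hpot : AdmissiblePotentials W Φ)
    (hT : 0 < T) (hμ₀ : μ₀ univ ≤ 1) (hε : 0 ≤ ε) {S : Set (Measure (Phase d))}
    (hS : MomentumTight S) (hdS : ∀ h t : ℝ, 0 < h → t ∈ Icc 0 T → discretized W Φ ε h μ₀ t ∈ S)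
    {φ : ℝ × Phase d → ℝ} {K : Set (Phase d)} (hφ : ContDiff ℝ 1 φ)
    (hK : IsCompact K) (hφK : ∀ t x, x ∉ K → φ (t, x) = 0) (hφ0 : ∀ x, φ (0, x) = 0)
    (hφT : ∀ x, φ (T, x) = 0) : IsWeakSolution W Φ T ε φ μ μ := by
  have hmass := fun t ht => hμ.univ_le_one hpot hT hμ₀ hε (t := t) ht
  obtain ⟨hfin, n, hnm, hn0, hn⟩ := hμ
  have hh : ∀ k, 0 < T / (n k : ℝ) := fun k => div_pos hT (Nat.cast_pos.2 (hn0 k))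
  have hnode : ∀ k t, t ∈ Icc 0 T → ⌊t / (T / n k)⌋₊ * (T / n k) ∈ Icc 0 T := fun k t ht =>
    ⟨mul_nonneg (Nat.cast_nonneg _) (hh k).le, (mem_Icc_floor (hh k) ht.1).1.trans ht.2⟩
  refine isWeakSolution_of_tendsto hpot (ε := fun _ => ε) (ε₀ := ε) (fun _ => hε) (fun _ => le_rfl)
    tendsto_const_nhds hn (f := fun k t => discreteNode W Φ ε (T / n k) μ₀ ⌊t / (T / n k)⌋₊)
    (fun t ht ψ hψ hψc => ?_)
    (fun k t ht => discretized_univ_le hpot hε (hh k) hμ₀ ht.1)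
    (fun k t ht => discreteNode_univ_le hpot hε (hh k).le hμ₀ _) hmass hmass hS
    (fun k t ht => ?_) hφ hK hφK
    (fun k => isWeakSolution_discretized hpot hε (hh k) hμ₀ hT.le hφ hK hφK hφ0 hφT)
  · obtain ⟨C, hC0, hC⟩ := hpot.exists_lipschitz_discretized hμ₀ T ε hψ hψc
    have hstep : Tendsto (fun k => C * (T / (n k : ℝ))) atTop (𝓝 0) := by
      have h1 : Tendsto (fun k => (n k : ℝ)) atTop atTop :=
        tendsto_natCast_atTop_atTop.comp hnm.tendsto_atTop
      simpa using (h1.const_div_atTop T).const_mul C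
    have hdiff : Tendsto (fun k => ∫ x, ψ x ∂(discretized W Φ ε (T / n k) μ₀ t) -
        ∫ x, ψ x ∂(discreteNode W Φ ε (T / n k) μ₀ ⌊t / (T / n k)⌋₊)) atTop (𝓝 0) := by
      refine squeeze_zero_norm (fun k => ?_) hstep
      have hk := mem_Icc_floor (hh k) ht.1
      rw [← discretized_node (hh k), Real.norm_eq_abs]
      refine (hC ε _ hε le_rfl (hh k) _ (hnode k t ht) t ht).trans ?_
      rw [abs_of_nonneg (sub_nonneg.2 hk.1)]
      gcongr
      linarith [hk.2]
    have := (hn t ht ψ hψ hψc).sub hdiff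
    simpa using this
  · have := hdS _ _ (hh k) (hnode k t ht)
    rwa [discretized_node (hh k)] at this

end IsDiscretizationLimit

lemma solvesHamiltonianODE_of_isWeakSolution {d : ℕ} {W Φ : Pos d → ℝ}
    (hpot : AdmissiblePotentials W Φ) {T : ℝ} (hT : 0 < T) {ν : ℝ → Measure (Phase d)}
    (hν : ∀ t ∈ Icc 0 T, ν t univ ≤ 1)
    (hweak : ∀ (φ : ℝ × Phase d → ℝ) (K : Set (Phase d)), ContDiff ℝ 1 φ → IsCompact K →
      (∀ t x, x ∉ K → φ (t, x) = 0) → (∀ x, φ (0, x) = 0) → (∀ x, φ (T, x) = 0) →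
      IsWeakSolution W Φ T 0 φ ν ν) : SolvesHamiltonianODE W Φ T ν := by
  intro φ hφ hφc hφs
  have hφ1 : ContDiff ℝ 1 φ := hφ.of_le (by exact_mod_cast le_top)
  have hK : IsCompact (Prod.snd '' tsupport φ) := hφc.isCompact.image continuous_snd
  have hφK : ∀ t x, x ∉ Prod.snd '' tsupport φ → φ (t, x) = 0 := fun t x hx =>
    image_eq_zero_of_notMem_tsupport fun h => hx ⟨_, h, rfl⟩
  have hφend : ∀ t ∉ Ioo 0 T, ∀ x, φ (t, x) = 0 := fun t ht x =>
    image_eq_zero_of_notMem_tsupport fun h => ht (hφs h).1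
  obtain ⟨h1, h2⟩ := hweak φ _ hφ1 hK hφK (hφend 0 fun h => h.1.false) (hφend T fun h => h.2.false)
  obtain ⟨C, hC, hgen⟩ := hpot.exists_bound_generator hφ1 hK hφK T 0
  have hform : ∀ t, (∫ x, deficientGenerator 0 (hamField W Φ (ν t)) φ (t, x) ∂(ν t)) =
      ∫ x, (fderiv ℝ φ (t, x) (1, 0) + fderiv ℝ φ (t, x) (0, hamField W Φ (ν t) x)) ∂(ν t) :=
    fun t => by simp [deficientGenerator]
  have hint : IntegrableOn
      (fun t => ∫ x, deficientGenerator 0 (hamField W Φ (ν t)) φ (t, x) ∂(ν t)) (Ioc 0 T) :=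
    Integrable.of_bound h1 C ((ae_restrict_mem measurableSet_Ioc).mono fun t ht =>
      norm_integral_le_of_mass_le_one (hν t (Ioc_subset_Icc_self ht)) hC
        (hgen 0 le_rfl le_rfl _ (hν t (Ioc_subset_Icc_self ht)) t (Ioc_subset_Icc_self ht)))
  simp only [hform] at hint h2
  exact ⟨(intervalIntegrable_iff_integrableOn_Ioc_of_le hT.le).2 hint, by
    rw [intervalIntegral.integral_of_le hT.le, h2]⟩

theorem mainTheorem2 {d : ℕ} (W Φ : Pos d → ℝ) (hpot : AdmissiblePotentials W Φ)
    (hdyn : DynamicalHypothesis W Φ) (T : ℝ) (hT : 0 < T) (α₀ : ℝ) (hα₀ : 0 < α₀)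
    (μ₀ : Measure (Phase d)) (hμ₀ : μ₀ univ = 1)
    (hexp : Integrable (fun x : Phase d => Real.exp (α₀ * ‖x‖)) μ₀) :
    (∀ ε : ℝ, 0 < ε → ∃ μ : ℝ → Measure (Phase d), IsDiscretizationLimit W Φ T ε μ₀ μ) ∧
    ∀ μ : ℝ → ℝ → Measure (Phase d),
      (∀ ε : ℝ, 0 < ε → IsDiscretizationLimit W Φ T ε μ₀ (μ ε)) →
      ∃ (ε : ℕ → ℝ) (ν : ℝ → Measure (Phase d)),
        StrictAnti ε ∧ (∀ k, 0 < ε k) ∧ Tendsto ε atTop (𝓝 0) ∧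
        (∀ t ∈ Icc 0 T, DistTendsto (fun k => μ (ε k) t) atTop (ν t)) ∧
        ν 0 = μ₀ ∧
        (∀ t ∈ Icc 0 T, DistTendsto ν (𝓝[Icc 0 T] t) (ν t)) ∧
        (∀ t ∈ Icc 0 T, ν t univ ≤ 1) ∧
        SolvesHamiltonianODE W Φ T ν := by
  refine ⟨fun ε hε => exists_isDiscretizationLimit hpot hT hμ₀.le hε.le, fun μ hμ => ?_⟩
  have hfin₀ := isFiniteMeasure_of_le_one hμ₀.le
  obtain ⟨S, hS, hdS, hSclosed⟩ := exists_momentumTight_discretized hpot hdyn hμ₀.le T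
  have hmass : ∀ ε, 0 < ε → ∀ t ∈ Icc 0 T, μ ε t univ ≤ 1 := fun ε hε t ht =>
    (hμ ε hε).univ_le_one hpot hT hμ₀.le hε.le ht
  have hμS : ∀ ε, 0 < ε → ∀ t ∈ Icc 0 T, μ ε t ∈ S := by
    intro ε hε t ht
    obtain ⟨hfin, n, -, hn0, hn⟩ := hμ ε hε
    have hh : ∀ k, 0 < T / (n k : ℝ) := fun k => div_pos hT (Nat.cast_pos.2 (hn0 k))
    exact hSclosed _ _ (hfin t ht) (fun k => discretized_univ_le hpot hε.le (hh k) hμ₀.le ht.1)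
      (fun k => hdS ε _ t hε.le (hh k) ht) (hn t ht)
  have hLip : ∀ ψ : Phase d → ℝ, ContDiff ℝ ∞ ψ → HasCompactSupport ψ → ∃ C : ℝ, ∀ ε, 0 < ε →
      ε ≤ 1 → ∀ s ∈ Icc 0 T, ∀ t ∈ Icc 0 T,
        |∫ x, ψ x ∂(μ ε t) - ∫ x, ψ x ∂(μ ε s)| ≤ C * |t - s| := by
    intro ψ hψ hψc
    obtain ⟨C, -, hC⟩ := hpot.exists_lipschitz_discretized hμ₀.le T 1 hψ hψc
    exact ⟨C, fun ε hε hε1 s hs t ht => (hμ ε hε).lipschitz hT hψ hψc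
      (fun h hh => hC ε h hε.le hε1 hh) hs ht⟩
  have he0 : ∀ n : ℕ, (0 : ℝ) < 1 / ((n : ℝ) + 1) := fun n => by positivity
  have he1 : ∀ n : ℕ, 1 / ((n : ℝ) + 1) ≤ 1 := fun n => by
    rw [div_le_one (by positivity)]
    linarith [n.cast_nonneg (α := ℝ)]
  obtain ⟨σ, hσ, ν, hν1, hν⟩ := exists_subseq_distTendsto hT.le
    (fun n : ℕ => μ (1 / ((n : ℝ) + 1))) (fun n => hmass _ (he0 n)) (fun ψ hψ hψc => by
      obtain ⟨C, hC⟩ := hLip ψ hψ hψc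
      exact ⟨C, fun n => hC _ (he0 n) (he1 n)⟩)
  have hνfin := fun t => isFiniteMeasure_of_le_one (hν1 t)
  have hlim : Tendsto (fun k => 1 / ((σ k : ℝ) + 1)) atTop (𝓝 0) :=
    (tendsto_one_div_add_atTop_nhds_zero_nat (𝕜 := ℝ)).comp hσ.tendsto_atTop
  refine ⟨fun k => 1 / ((σ k : ℝ) + 1), ν, fun a b hab => ?_, fun k => he0 _, hlim, hν, ?_, ?_,
    fun t _ => hν1 t, ?_⟩
  · have : (σ a : ℝ) < σ b := Nat.cast_lt.2 (hσ hab)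
    exact one_div_lt_one_div_of_lt (by positivity) (by linarith)
  · have h0 : (0 : ℝ) ∈ Icc 0 T := ⟨le_rfl, hT.le⟩
    have h1 := hν 0 h0
    simp only [fun k => (hμ _ (he0 (σ k))).apply_zero hT hμ₀.le] at h1
    exact h1.unique (fun φ _ _ => tendsto_const_nhds) (Eventually.of_forall fun _ => hμ₀.le)
  · intro t ht ψ hψ hψc
    obtain ⟨C, hC⟩ := hLip ψ hψ hψc
    have hb : ∀ s ∈ Icc 0 T, |∫ x, ψ x ∂(ν s) - ∫ x, ψ x ∂(ν t)| ≤ C * |s - t| := fun s hs =>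
      le_of_tendsto (((hν s hs ψ hψ hψc).sub (hν t ht ψ hψ hψc)).abs)
        (Eventually.of_forall fun k => hC _ (he0 _) (he1 _) t ht s hs)
    rw [tendsto_iff_norm_sub_tendsto_zero]
    refine squeeze_zero' (Eventually.of_forall fun _ => norm_nonneg _)
      (eventually_nhdsWithin_of_forall hb) ?_
    have hc : Continuous fun s : ℝ => C * |s - t| := by fun_prop
    simpa using (hc.tendsto t).mono_left nhdsWithin_le_nhds
  · refine solvesHamiltonianODE_of_isWeakSolution hpot hT (fun t _ => hν1 t)
      fun φ K hφ hK hφK hφ0 hφT => ?_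
    exact isWeakSolution_of_tendsto hpot (ε₀ := 1) (fun k => (he0 (σ k)).le) (fun k => he1 (σ k))
      hlim hν hν (fun k => hmass _ (he0 _)) (fun k => hmass _ (he0 _)) (fun t _ => hν1 t)
      (fun t _ => hν1 t) hS (fun k => hμS _ (he0 _)) hφ hK hφK
      (fun k => (hμ _ (he0 _)).isWeakSolution hpot hT hμ₀.le (he0 _).le hS
        (fun h t hh ht => hdS _ h t (he0 _).le hh ht) hφ hK hφK hφ0 hφT)
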